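/- Let $d$ be a dimension, let $\mathcal P$ be the set of probability vectors $(p_z)_{z\in\mathbb Z^d}$ on $\mathbb Z^d$ (with the $\sigma$-field generated by the coordinates), and let $\Omega=\mathcal P^{\mathbb Z^d}$ be the space of environments $\omega=(\omega_x)_{x\in\mathbb Z^d}$, $\omega_x=(\omega_{x,z})_{z\in\mathbb Z^d}$, with its product $\sigma$-field. Put $\pi_{x,y}(\omega)=\omega_{x,y-x}$. For fixed $\omega$ let $P_z^\omega$ be the law (with expectation $E_z^\omega$) on paths $(X_n)_{n\ge0}$ in $\mathbb Z^d$ of the Markov chain with $X_0=z$ and transition probabilities $\pi_{x,y}(\omega)$. Let $\mathbb P$ (with expectation $\mathbb E$) be an i.i.d. product probability measure on $\Omega$, i.e. the vectors $\omega_x$ are i.i.d. under $\mathbb P$, and let $P_0=\int P_0^\omega\,\mathbb P(d\omega)$ and $P_{0,0}=\int P_0^\omega\otimes P_0^\omega\,\mathbb P(d\omega)$, with expectations $E_0$ and $E_{0,0}$; under $P_{0,0}$ the pair $(X,\widetilde X)$ consists of two walks from $0$ that are independent given the common environment. Write $X_{[0,n)}=\{X_k:0\le k<n\}$ and let $|\cdot|$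 denote the Euclidean norm of a vector and the number of elements of a finite set. Assume: (N) there are $\hat u\in\mathbb Z^d\setminus\{0\}$ and $\delta>0$ such that $\sum_{z}z\cdot\hat u\,\pi_{0,z}(\omega)\ge\delta$ for $\mathbb P$-almost every $\omega$; (M) there are $M,s_0>0$ such that $\sum_z e^{s_0|z|}\pi_{0,z}(\omega)\le e^{s_0M}$ for $\mathbb P$-almost every $\omega$. Assume moreover that for some $\bar\alpha<1/2$, $$E_{0,0}\bigl(|X_{[0,n)}\cap\widetilde X_{[0,n)}|\bigr)=O(n^{2\bar\alpha})\qquad(n\to\infty).$$ Then $X_n$ is integrable under $P_0$ and $\omega\mapsto E_0^\omega(X_n)$ is in $L^2(\mathbb P)$ for every $n\ge 0$, and there is an $\alpha<1/2$ such that $$\mathbb E\bigl(|E_0^\omega(X_n)-E_0(X_n)|^2\bigr)=O(n^{2\alpha})\qquad(n\to\infty).$$ -/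

import Mathlib

open MeasureTheory ProbabilityTheory Filter Asymptotics
open scoped ENNReal

namespace RWRE

/-- The integer lattice `ℤ^d`. -/
abbrev Lattice (d : ℕ) : Type := Fin d → ℤ

/-- The simplex `𝒫` of probability vectors on `ℤ^d` (every `PMF` is a nonnegative family of
total mass one). -/
abbrev Simplex (d : ℕ) : Type := PMF (Lattice d)

/-- The simplex carries the `σ`-field generated by the coordinates `p ↦ p z`. -/
instance simplexMeasurableSpace (d : ℕ) : MeasurableSpace (Simplex d) :=
  MeasurableSpace.comap (fun (p : Simplex d) (z : Lattice d) => p z) MeasurableSpace.pi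

/-- Environments `ω = (ω_x)_{x ∈ ℤ^d}`; the `σ`-field is the product one. -/
abbrev Env (d : ℕ) : Type := Lattice d → Simplex d

/-- Infinite lattice paths `x_{0,∞}`. -/
abbrev Path (d : ℕ) : Type := ℕ → Lattice d

/-- The lattice `ℤ^d` inside Euclidean space `ℝ^d`. -/
noncomputable def toEuclid {d : ℕ} (z : Lattice d) : EuclideanSpace ℝ (Fin d) :=
  WithLp.toLp 2 (fun i => (z i : ℝ))

/-- The transition probability `π_{x,y}(ω) = ω_{x,y-x}`, as a real number. -/
noncomputable def transProb {d : ℕ} (ω : Env d) (x y : Lattice d) : ℝ :=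
  (ω x (y - x)).toReal

/-- The law of the i.i.d. product environment in which each `ω_x` has law `μ`. -/
noncomputable def iidEnv {d : ℕ} (μ : Measure (Simplex d)) : Measure (Env d) :=
  Measure.infinitePi (fun _ : Lattice d => μ)

/-- Non-nestling: there are `û ∈ ℤ^d \ {0}` and `δ > 0` with
`∑_z (z · û) π_{0,z}(ω) ≥ δ` for almost every `ω` (the sum being absolutely convergent). -/
def NonNestling {d : ℕ} (P : Measure (Env d)) : Prop :=
  ∃ (u : Lattice d) (δ : ℝ), u ≠ 0 ∧ 0 < δ ∧ ∀ᵐ ω ∂P,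
    Summable (fun z : Lattice d => ((z ⬝ᵥ u : ℤ) : ℝ) * transProb ω 0 z) ∧
    δ ≤ ∑' z : Lattice d, ((z ⬝ᵥ u : ℤ) : ℝ) * transProb ω 0 z

/-- Exponential moments: there are `M > 0` and `s₀ > 0` with
`∑_z e^{s₀|z|} π_{0,z}(ω) ≤ e^{s₀ M}` for almost every `ω` (in particular the sum is finite). -/
def ExpMoment {d : ℕ} (P : Measure (Env d)) : Prop :=
  ∃ M s₀ : ℝ, 0 < M ∧ 0 < s₀ ∧ ∀ᵐ ω ∂P,
    Summable (fun z : Lattice d => Real.exp (s₀ * ‖toEuclid z‖) * transProb ω 0 z) ∧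
    ∑' z : Lattice d, Real.exp (s₀ * ‖toEuclid z‖) * transProb ω 0 z ≤ Real.exp (s₀ * M)

/-- The one-step transition kernel in the environment `ω`: from `x` the walk jumps to `x + z`
with probability `ω_{x,z}`. -/
noncomputable def stepKernel {d : ℕ} (ω : Env d) : Kernel (Lattice d) (Lattice d) where
  toFun x := ((ω x).map (fun z => x + z)).toMeasure
  measurable' := measurable_of_countable _

instance {d : ℕ} (ω : Env d) : IsMarkovKernel (stepKernel ω) :=
  ⟨fun x => inferInstanceAs (IsProbabilityMeasure ((ω x).map (fun z => x + z)).toMeasure)⟩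

/-- The same kernel as a function of the whole history: only the present position matters. -/
noncomputable def histKernel {d : ℕ} (ω : Env d) (n : ℕ) :
    Kernel (Finset.Iic n → Lattice d) (Lattice d) :=
  (stepKernel ω).comap (fun h => h ⟨n, Finset.mem_Iic.2 le_rfl⟩) (measurable_pi_apply _)

instance {d : ℕ} (ω : Env d) (n : ℕ) : IsMarkovKernel (histKernel ω n) := by
  unfold histKernel; infer_instance

/-- The quenched path measure `P_z^ω`: the law of the Markov chain started at `z` with transition
probabilities `π_{x,y}(ω)`. -/
noncomputable def quenchedLaw {d : ℕ} (z : Lattice d) (ω : Env d) : Measure (Path d) :=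
  Kernel.traj (X := fun _ => Lattice d) (histKernel ω) 0 (fun _ => z)

instance {d : ℕ} (z : Lattice d) (ω : Env d) : IsProbabilityMeasure (quenchedLaw z ω) := by
  unfold quenchedLaw; infer_instance

lemma measurable_coord {d : ℕ} (x z : Lattice d) : Measurable (fun ω : Env d => ω x z) := by
  have h : Measurable (fun p : Simplex d => p z) :=
    (measurable_pi_apply z).comp (comap_measurable (fun (p : Simplex d) (z : Lattice d) => p z))
  exact h.comp (measurable_pi_apply x)

lemma measurable_stepKernel {d : ℕ} (x : Lattice d) {s : Set (Lattice d)} (hs : MeasurableSet s) :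
    Measurable (fun ω : Env d => stepKernel ω x s) := by
  classical
  have h : (fun ω : Env d => stepKernel ω x s) =
      fun ω => ∑' z : Lattice d, if x + z ∈ s then ω x z else 0 := by
    funext ω
    change ((ω x).map (fun z => x + z)).toMeasure s = _
    rw [PMF.toMeasure_map_apply _ _ _ (measurable_of_countable _) hs,
      PMF.toMeasure_apply _ (measurable_of_countable (fun z => x + z) hs)]
    rfl
  rw [h]
  refine Measurable.tsum fun z => ?_
  split_ifs
  · exact measurable_coord x z
  · exact measurable_const

lemma measurable_partialTraj {d : ℕ} (z : Lattice d) (n : ℕ) :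
    Measurable (fun ω : Env d =>
      Kernel.partialTraj (X := fun _ => Lattice d) (histKernel ω) 0 n (fun _ => z)) := by
  induction n with
  | zero => simp only [Kernel.partialTraj_zero]; exact measurable_const
  | succ n ih =>
    refine Measure.measurable_of_measurable_coe _ fun s hs => ?_
    have h : ∀ ω : Env d,
        Kernel.partialTraj (X := fun _ => Lattice d) (histKernel ω) 0 (n + 1) (fun _ => z) s =
        ∑' y : Finset.Iic n → Lattice d,
          stepKernel ω (y ⟨n, Finset.mem_Iic.2 le_rfl⟩)
            {w | IicProdIoc (X := fun _ => Lattice d) n (n + 1)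
              (y, MeasurableEquiv.piSingleton (X := fun _ => Lattice d) n w) ∈ s} *
          Kernel.partialTraj (X := fun _ => Lattice d) (histKernel ω) 0 n (fun _ => z) {y} := by
      intro ω
      rw [Kernel.partialTraj_succ_of_le (Nat.zero_le n),
        Kernel.map_apply' _ (by fun_prop) _ hs,
        Kernel.comp_apply' _ _ _ (by measurability), lintegral_countable']
      refine tsum_congr fun y => ?_
      congr 1
      rw [Kernel.id_prod_apply' _ _ (by measurability),
        Kernel.map_apply' _ (by fun_prop) _ (by measurability)]
      rfl
    simp only [h]
    refine Measurable.tsum fun y => ?_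
    refine (measurable_stepKernel _ (Set.to_countable _).measurableSet).mul ?_
    exact (Measure.measurable_coe (measurableSet_singleton y)).comp ih

lemma measurable_quenchedLaw {d : ℕ} (z : Lattice d) :
    Measurable (fun ω : Env d => quenchedLaw z ω) := by
  refine Measurable.measure_of_isPiSystem_of_isProbabilityMeasure
    (generateFrom_measurableCylinders (α := fun _ : ℕ => Lattice d)).symm
    isPiSystem_measurableCylinders ?_
  intro s hs
  simp only [measurableCylinders_nat, Set.mem_iUnion, Set.mem_singleton_iff] at hs
  obtain ⟨n, S, hS, rfl⟩ := hs
  have h : ∀ ω : Env d, quenchedLaw z ω (cylinder (Finset.Iic n) S) =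
      Kernel.partialTraj (X := fun _ => Lattice d) (histKernel ω) 0 n (fun _ => z) S := by
    intro ω
    rw [← Kernel.traj_map_frestrictLe_apply,
      Measure.map_apply (Preorder.measurable_frestrictLe n) hS]
    rfl
  simp only [h]
  exact (Measure.measurable_coe hS).comp (measurable_partialTraj z n)

/-- The quenched path measures `P_z^ω`, as a probability kernel from environments to paths. -/
noncomputable def quenched {d : ℕ} (z : Lattice d) : Kernel (Env d) (Path d) where
  toFun ω := quenchedLaw z ω
  measurable' := measurable_quenchedLaw z

instance {d : ℕ} (z : Lattice d) : IsMarkovKernel (quenched z) :=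
  ⟨fun ω => inferInstanceAs (IsProbabilityMeasure (quenchedLaw z ω))⟩

/-- The averaged path measure `P_z = ∫ P_z^ω P(dω)`. -/
noncomputable def averaged {d : ℕ} (P : Measure (Env d)) (z : Lattice d) : Measure (Path d) :=
  P.bind (quenched z)

/-- The averaged law `P_{x,y} = ∫ P_x^ω ⊗ P_y^ω P(dω)` of two walks, started at `x` and `y`, that
are independent given the common environment. -/
noncomputable def averagedPair {d : ℕ} (P : Measure (Env d)) (x y : Lattice d) :
    Measure (Path d × Path d) :=
  P.bind (quenched x ×ₖ quenched y)

/-- The quenched mean `E_0^ω(X_n)`. -/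
noncomputable def quenchedMean {d : ℕ} (n : ℕ) (ω : Env d) : EuclideanSpace ℝ (Fin d) :=
  ∫ X, toEuclid (X n) ∂(quenched 0 ω)

/-- The averaged mean `E_0(X_n)`. -/
noncomputable def averagedMean {d : ℕ} (P : Measure (Env d)) (n : ℕ) : EuclideanSpace ℝ (Fin d) :=
  ∫ X, toEuclid (X n) ∂(averaged P 0)

/-- The set of visited sites `X_{[0,n)} = {X_k : 0 ≤ k < n}`. -/
def sites {d : ℕ} (X : Path d) (n : ℕ) : Finset (Lattice d) :=
  (Finset.range n).image X

end RWRE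

/-! Each coordinate of the quenched mean is the additive functional `∑_{k<n} E_0^ω β(ω_{X_k})` of
the local drift `β` (`quenchedMean_apply`), encoded by the recursion `expSum`. Its variance is split
orthogonally by revealing the environment in order of increasing level `ℓ z = z · û`. The increment
at `z` is the effect of resampling `ω_z`, averaged over sites not yet revealed; by Jensen it is
enough to average over the levels at least `ℓ z + 1 + L` (`integral_sq_sub_le`).

Resampling `ω_z` matters only if the walk visits `z`. After the visit the walk drifts upwards into
averaged environment, where a new start looks the same whatever lies behind, up to the influence of
the environment below the starting level. That influence is bounded by induction on time
(`oscLE_succ`, `oscLE_oscBound`): to feel it the walk must step below its starting level, which has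
probability at most `e^{-s}`, and it then climbs back through a slab of thickness `L` at a cost of
order `e^{s'L}`. A return from above the slab has probability at most `e^{-sL}`. With `L` close to
`(3/s) log n` and `s'` much smaller than `s`, the influence is an arbitrarily small power of `n`.

Hence the increment at `z` is at most `n^ε P_0^ω(visit z)` plus a negligible term
(`abs_avg_sub_le_site`). The sum over `z` of `P_0^ω(visit z)^2` is the expected number of common
sites of two independent walks in `ω`, so the variance is at most of order `n^{2ε} n^{2ᾱ}`
(`variance_expSum_le`). All walk estimates compare first-step recursions with supersolutions.
Integrability follows from the uniform bound on the mean jump length. -/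

namespace RWRE

/-! ### Averaging over coordinates of an i.i.d. configuration, and the martingale variance bound. -/

section Averaging

/-- Bounded measurable real functions. -/
def BddMeas {α : Type*} [MeasurableSpace α] (g : α → ℝ) : Prop :=
  Measurable g ∧ ∃ C : ℝ, ∀ a, |g a| ≤ C

namespace BddMeas

variable {α β : Type*} [MeasurableSpace α] [MeasurableSpace β] {f g : α → ℝ}

lemma integrable (hg : BddMeas g) (P : Measure α) [IsFiniteMeasure P] : Integrable g P := by
  obtain ⟨C, hC⟩ := hg.2
  exact Integrable.of_bound hg.1.aestronglyMeasurable C (ae_of_all _ hC)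

lemma comp (hg : BddMeas g) {h : β → α} (hh : Measurable h) : BddMeas (fun b => g (h b)) :=
  ⟨hg.1.comp hh, hg.2.imp fun _ hC b => hC (h b)⟩

lemma const (c : ℝ) : BddMeas (fun _ : α => c) := ⟨measurable_const, |c|, fun _ => le_rfl⟩

lemma sub (hf : BddMeas f) (hg : BddMeas g) : BddMeas (fun a => f a - g a) := by
  obtain ⟨C, hC⟩ := hf.2
  obtain ⟨D, hD⟩ := hg.2
  exact ⟨hf.1.sub hg.1, C + D, fun a => (abs_sub _ _).trans (add_le_add (hC a) (hD a))⟩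

lemma add (hf : BddMeas f) (hg : BddMeas g) : BddMeas (fun a => f a + g a) := by
  obtain ⟨C, hC⟩ := hf.2
  obtain ⟨D, hD⟩ := hg.2
  exact ⟨hf.1.add hg.1, C + D, fun a => (abs_add_le _ _).trans (add_le_add (hC a) (hD a))⟩

lemma mul (hf : BddMeas f) (hg : BddMeas g) : BddMeas (fun a => f a * g a) := by
  obtain ⟨C, hC⟩ := hf.2
  obtain ⟨D, hD⟩ := hg.2
  refine ⟨hf.1.mul hg.1, C * D, fun a => ?_⟩
  rw [abs_mul]
  exact mul_le_mul (hC a) (hD a) (abs_nonneg _) ((abs_nonneg _).trans (hC a))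

lemma pow (hf : BddMeas f) : BddMeas (fun a => f a ^ 2) := by
  simpa only [sq] using hf.mul hf

lemma sqrt (hf : BddMeas f) : BddMeas (fun a => √(f a)) := by
  obtain ⟨C, hC⟩ := hf.2
  refine ⟨hf.1.sqrt, √C, fun a => ?_⟩
  rw [abs_of_nonneg (Real.sqrt_nonneg _)]
  exact Real.sqrt_le_sqrt ((le_abs_self _).trans (hC a))

lemma integral_sq_le (hf : BddMeas f) (P : Measure α) [IsProbabilityMeasure P] :
    (∫ a, f a ∂P) ^ 2 ≤ ∫ a, f a ^ 2 ∂P :=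
  ConvexOn.map_integral_le (g := fun x : ℝ => x ^ 2) (even_two.convexOn_pow)
    (continuous_pow 2).continuousOn isClosed_univ (ae_of_all _ fun _ => Set.mem_univ _)
    (hf.integrable P) (hf.pow.integrable P)

lemma integral_kernel {κ : Kernel α β} [IsMarkovKernel κ] {h : α × β → ℝ} (hh : BddMeas h) :
    BddMeas (fun a => ∫ b, h (a, b) ∂κ a) := by
  obtain ⟨C, hC⟩ := hh.2
  refine ⟨(hh.1.stronglyMeasurable.integral_kernel_prod_right' (κ := κ)).measurable, C,
    fun a => ?_⟩
  simpa using norm_integral_le_of_norm_le_const (μ := κ a) (f := fun b => h (a, b))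
    (ae_of_all _ fun b => hC (a, b))

lemma integral_prod_right {Q : Measure β} [IsProbabilityMeasure Q] {h : α × β → ℝ}
    (hh : BddMeas h) : BddMeas (fun a => ∫ b, h (a, b) ∂Q) := by
  simpa using hh.integral_kernel (κ := Kernel.const α Q)

end BddMeas

lemma abs_integral_le_of_le {α : Type*} [MeasurableSpace α] {P : Measure α}
    [IsProbabilityMeasure P] {f : α → ℝ} {C : ℝ} (h : ∀ a, |f a| ≤ C) : |∫ a, f a ∂P| ≤ C := by
  simpa using norm_integral_le_of_norm_le_const (μ := P) (f := f) (ae_of_all _ h)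

variable {I S : Type*}

open Classical in
/-- The configuration equal to `η` on `A` and to `ω` off `A`. -/
noncomputable def merge (A : Set I) (η ω : I → S) : I → S := fun i => if i ∈ A then η i else ω i

lemma merge_of_mem {A : Set I} {i : I} (h : i ∈ A) (η ω : I → S) : merge A η ω i = η i := if_pos h

lemma merge_of_notMem {A : Set I} {i : I} (h : i ∉ A) (η ω : I → S) : merge A η ω i = ω i :=
  if_neg h

lemma merge_merge (A B : Set I) (ζ η ω : I → S) :
    merge B ζ (merge A η ω) = merge (A ∪ B) (merge B ζ η) ω := by
  funext i
  by_cases hB : i ∈ B <;> by_cases hA : i ∈ A <;> simp [merge, hA, hB]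

variable [MeasurableSpace S]

lemma measurable_merge (A : Set I) :
    Measurable (fun p : (I → S) × (I → S) => merge A p.2 p.1) := by
  refine measurable_pi_iff.2 fun i => ?_
  by_cases h : i ∈ A
  · simp only [merge_of_mem h]; fun_prop
  · simp only [merge_of_notMem h]; fun_prop

lemma measurable_merge_left (A : Set I) (ω : I → S) : Measurable (fun η => merge A η ω) :=
  (measurable_merge A).comp (measurable_const.prodMk measurable_id)

/-- On a box the coordinates in and off `A` factor. This makes `avg` a version of the conditional
expectation given the coordinates off `A`, defined at every configuration; the oscillation bounds
later on are suprema over all environments. -/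
lemma map_merge (μ : Measure S) [IsProbabilityMeasure μ] (A : Set I) :
    ((Measure.infinitePi fun _ : I => μ).prod (Measure.infinitePi fun _ : I => μ)).map
      (fun p => merge A p.2 p.1) = Measure.infinitePi fun _ : I => μ := by
  classical
  refine Measure.eq_infinitePi _ fun s t ht => ?_
  rw [Measure.map_apply (measurable_merge A) (.pi s.countable_toSet fun i _ => ht i)]
  have : (fun p : (I → S) × (I → S) => merge A p.2 p.1) ⁻¹' (Set.pi s t) =
      (Set.pi (s.filter (· ∉ A) : Finset I) t) ×ˢ (Set.pi (s.filter (· ∈ A) : Finset I) t) := by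
    ext p
    simp only [Set.mem_preimage, Set.mem_pi, Set.mem_prod, Finset.coe_filter, Set.mem_ofPred_eq,
      SetLike.mem_coe]
    constructor
    · intro h
      refine ⟨fun i hi => ?_, fun i hi => ?_⟩
      · simpa [merge, hi.2] using h i hi.1
      · simpa [merge, hi.2] using h i hi.1
    · rintro ⟨h1, h2⟩ i hi
      by_cases hA : i ∈ A
      · simpa [merge, hA] using h2 i ⟨hi, hA⟩
      · simpa [merge, hA] using h1 i ⟨hi, hA⟩
  rw [this, Measure.prod_prod, Measure.infinitePi_pi _ (fun i _ => ht i),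
    Measure.infinitePi_pi _ (fun i _ => ht i), mul_comm]
  exact Finset.prod_filter_mul_prod_filter_not s (· ∈ A) _

/-- Average out the coordinates in `A` of a function of an i.i.d. configuration. -/
noncomputable def avg (μ : Measure S) (A : Set I) (g : (I → S) → ℝ) (ω : I → S) : ℝ :=
  ∫ η, g (merge A η ω) ∂(Measure.infinitePi fun _ : I => μ)

variable (μ : Measure S) {g h : (I → S) → ℝ}

/-- `avg μ B g` does not depend on the coordinates in `B`. -/
lemma avg_merge_of_subset {A B : Set I} (hAB : A ⊆ B) (η ω : I → S) :
    avg μ B g (RWRE.merge A η ω) = avg μ B g ω := by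
  simp only [avg, merge_merge, Set.union_eq_right.2 hAB]
  congr 1
  funext ζ
  congr 1
  funext i
  by_cases hB : i ∈ B <;> simp [RWRE.merge, hB]

variable [IsProbabilityMeasure μ]

lemma BddMeas.merge (hg : BddMeas g) (A : Set I) (ω : I → S) :
    BddMeas (fun η => g (merge A η ω)) := hg.comp (measurable_merge_left A ω)

lemma BddMeas.avg (hg : BddMeas g) (A : Set I) : BddMeas (avg μ A g) :=
  BddMeas.integral_prod_right (hg.comp (measurable_merge A))

lemma avg_sub (hg : BddMeas g) (hh : BddMeas h) (A : Set I) (ω : I → S) :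
    avg μ A (fun ω => g ω - h ω) ω = avg μ A g ω - avg μ A h ω :=
  integral_sub ((hg.merge A ω).integrable _) ((hh.merge A ω).integrable _)

lemma avg_mono (hg : BddMeas g) (hh : BddMeas h) (A : Set I) (ω : I → S) (hgh : ∀ ω, g ω ≤ h ω) :
    avg μ A g ω ≤ avg μ A h ω :=
  integral_mono ((hg.merge A ω).integrable _) ((hh.merge A ω).integrable _) fun _ => hgh _

lemma integral_map_merge (A : Set I) (hg : BddMeas g) :
    ∫ p, g (RWRE.merge A p.2 p.1)
      ∂((Measure.infinitePi fun _ : I => μ).prod (Measure.infinitePi fun _ : I => μ)) =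
    ∫ ω, g ω ∂(Measure.infinitePi fun _ : I => μ) := by
  conv_rhs => rw [← map_merge μ A]
  rw [integral_map (measurable_merge A).aemeasurable hg.1.aestronglyMeasurable]

lemma integral_avg (A : Set I) (hg : BddMeas g) :
    ∫ ω, avg μ A g ω ∂(Measure.infinitePi fun _ : I => μ) =
    ∫ ω, g ω ∂(Measure.infinitePi fun _ : I => μ) := by
  rw [← integral_map_merge μ A hg,
    integral_prod _ ((hg.comp (measurable_merge A)).integrable _)]
  rfl

/-- Two successive resamplings amount to one resampling of `A ∪ B` by `merge B ζ η`, which is again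
i.i.d. -/
lemma avg_avg (A B : Set I) (hg : BddMeas g) (ω : I → S) :
    avg μ A (avg μ B g) ω = avg μ (A ∪ B) g ω := by
  have := integral_avg μ B (hg.merge (A ∪ B) ω)
  simp only [avg] at this ⊢
  simpa only [merge_merge] using this

lemma avg_avg_of_subset {A B : Set I} (hBA : B ⊆ A) (hg : BddMeas g) (ω : I → S) :
    avg μ A (avg μ B g) ω = avg μ A g ω := by
  rw [avg_avg μ A B hg, Set.union_eq_left.2 hBA]

lemma sq_avg_le (A : Set I) (hg : BddMeas g) (ω : I → S) :
    (avg μ A g ω) ^ 2 ≤ avg μ A (fun ω => g ω ^ 2) ω :=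
  (hg.merge A ω).integral_sq_le _

lemma integral_sq_avg_le (A : Set I) (hg : BddMeas g) :
    ∫ ω, avg μ A g ω ^ 2 ∂(Measure.infinitePi fun _ : I => μ) ≤
    ∫ ω, g ω ^ 2 ∂(Measure.infinitePi fun _ : I => μ) := by
  rw [← integral_avg μ A hg.pow]
  exact integral_mono ((hg.avg μ A).pow.integrable _) ((hg.pow.avg μ A).integrable _)
    fun ω => sq_avg_le μ A hg ω

/-- Since `avg μ B g` ignores the coordinates in `B`, it factors out of both averages, and both
sides equal the integral of `g * avg μ B g`. This is the orthogonality of martingale increments. -/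
lemma integral_avg_mul_avg {A B : Set I} (hAB : A ⊆ B) (hg : BddMeas g) :
    ∫ ω, avg μ A g ω * avg μ B g ω ∂(Measure.infinitePi fun _ : I => μ) =
    ∫ ω, avg μ B g ω ^ 2 ∂(Measure.infinitePi fun _ : I => μ) := by
  have key : ∀ C : Set I, C ⊆ B → ∀ ω,
      avg μ C (fun ω => g ω * avg μ B g ω) ω = avg μ C g ω * avg μ B g ω := by
    intro C hC ω
    simp only [avg.eq_1 μ C]
    rw [← integral_mul_const]
    simp only [avg_merge_of_subset μ hC]
  have hb := hg.mul (hg.avg μ B)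
  simp only [← key A hAB, sq]
  simp only [← key B subset_rfl]
  rw [integral_avg μ A hb, integral_avg μ B hb]

/-- Orthogonal decomposition of the variance along an order in which a level function increases. -/
lemma integral_sq_avg_compl_le (ℓ : I → ℤ) (hg : BddMeas g) (W : I → Set I)
    (hW : ∀ z, ∀ j ∈ W z, ℓ z < ℓ j) (s : Finset I) :
    ∫ ω, avg μ (s : Set I)ᶜ g ω ^ 2 ∂(Measure.infinitePi fun _ : I => μ) ≤
    (∫ ω, g ω ∂(Measure.infinitePi fun _ : I => μ)) ^ 2 +
      ∑ z ∈ s, ∫ ω, avg μ (W z) (fun ω => g ω - avg μ {z} g ω) ω ^ 2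
        ∂(Measure.infinitePi fun _ : I => μ) := by
  classical
  induction s using Finset.induction_on_max_value ℓ with
  | empty =>
    have : ∀ ω : I → S, avg μ Set.univ g ω = ∫ ω, g ω ∂(Measure.infinitePi fun _ : I => μ) := by
      intro ω
      have e : ∀ η, RWRE.merge Set.univ η ω = η :=
        fun η => funext fun i => merge_of_mem (Set.mem_univ i) η ω
      simp only [avg, e]
    simp [this]
  | insert z s hz hmax ih =>
    rw [Finset.sum_insert hz]
    set A : Set I := ((insert z s : Finset I) : Set I)ᶜ with hA
    have hun : (s : Set I)ᶜ = A ∪ {z} := by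
      ext i
      by_cases hi : i = z <;> simp [hA, hi, hz]
    have hAs : A ⊆ (s : Set I)ᶜ := hun ▸ Set.subset_union_left
    -- The inserted site has maximal level, so every revealed site lies at or below it and none
    -- belongs to `W z`.
    have hWA : W z ⊆ A := by
      intro j hj
      have hlt := hW z j hj
      simp only [hA, Finset.coe_insert, Set.mem_compl_iff, Set.mem_insert_iff, not_or]
      exact ⟨fun h => by simp [h] at hlt, fun h => absurd (hmax j h) (not_le.2 hlt)⟩
    have hgz : BddMeas (fun ω => g ω - avg μ {z} g ω) := hg.sub (hg.avg μ {z})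
    -- The martingale increment is an `A`-average of the `W z`-average; contractivity of `avg` in L²
    -- removes the outer one.
    have hdiff : ∀ ω, avg μ A g ω - avg μ (s : Set I)ᶜ g ω =
        avg μ A (avg μ (W z) (fun ω => g ω - avg μ {z} g ω)) ω := by
      intro ω
      rw [avg_avg_of_subset μ hWA hgz, avg_sub μ hg (hg.avg μ {z}), avg_avg μ A {z} hg, hun]
    have hle : ∫ ω, (avg μ A g ω - avg μ (s : Set I)ᶜ g ω) ^ 2
        ∂(Measure.infinitePi fun _ : I => μ) ≤
        ∫ ω, avg μ (W z) (fun ω => g ω - avg μ {z} g ω) ω ^ 2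
        ∂(Measure.infinitePi fun _ : I => μ) := by
      simp only [hdiff]
      exact integral_sq_avg_le μ A (hgz.avg μ (W z))
    have hexp : ∫ ω, (avg μ A g ω - avg μ (s : Set I)ᶜ g ω) ^ 2
        ∂(Measure.infinitePi fun _ : I => μ) =
        ∫ ω, avg μ A g ω ^ 2 ∂(Measure.infinitePi fun _ : I => μ) -
        ∫ ω, avg μ (s : Set I)ᶜ g ω ^ 2 ∂(Measure.infinitePi fun _ : I => μ) := by
      have h1 := integral_avg_mul_avg μ hAs hg
      have e : ∀ ω, (avg μ A g ω - avg μ (s : Set I)ᶜ g ω) ^ 2 =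
          avg μ A g ω ^ 2 - 2 * (avg μ A g ω * avg μ (s : Set I)ᶜ g ω) +
            avg μ (s : Set I)ᶜ g ω ^ 2 := fun ω => by ring
      have i1 := (hg.avg μ A).pow.integrable (Measure.infinitePi fun _ : I => μ)
      have i2 := (hg.avg μ (s : Set I)ᶜ).pow.integrable (Measure.infinitePi fun _ : I => μ)
      have i3 := ((hg.avg μ A).mul (hg.avg μ (s : Set I)ᶜ)).integrable
        (Measure.infinitePi fun _ : I => μ)
      simp only [e]
      rw [integral_add (f := fun ω => _ - _) (i1.sub (i3.const_mul 2)) i2, integral_sub i1 (i3.const_mul 2),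
        integral_const_mul, h1]
      ring
    linarith

/-- A function is local if it converges along configurations that stabilise at each site. -/
def IsLocal (g : (I → S) → ℝ) : Prop :=
  ∀ (ω : I → S) (u : Finset I → I → S), (∀ i, ∀ᶠ s in atTop, u s i = ω i) →
    Tendsto (fun s => g (u s)) atTop (nhds (g ω))

/-- The revealed finite set exhausts `I`. Locality makes the averages over its complement converge
pointwise to `g`, and boundedness lets dominated convergence carry the limit through the squares. -/
lemma integral_sq_sub_le [Countable I] (ℓ : I → ℤ) (hg : BddMeas g) (hloc : IsLocal g)
    (W : I → Set I) (hW : ∀ z, ∀ j ∈ W z, ℓ z < ℓ j) {B : ℝ}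
    (hB : ∀ s : Finset I, ∑ z ∈ s, ∫ ω, avg μ (W z) (fun ω => g ω - avg μ {z} g ω) ω ^ 2
        ∂(Measure.infinitePi fun _ : I => μ) ≤ B) :
    ∫ ω, (g ω - ∫ ω, g ω ∂(Measure.infinitePi fun _ : I => μ)) ^ 2
      ∂(Measure.infinitePi fun _ : I => μ) ≤ B := by
  set P := Measure.infinitePi fun _ : I => μ with hP
  obtain ⟨C, hC⟩ := hg.2
  have havg : ∀ ω, Tendsto (fun s : Finset I => avg μ (s : Set I)ᶜ g ω) atTop (nhds (g ω)) := by
    intro ω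
    have hc : ∫ _η : I → S, g ω ∂P = g ω := by simp
    rw [← hc]
    refine tendsto_integral_filter_of_dominated_convergence (fun _ => C)
      (Eventually.of_forall fun s => (hg.merge _ ω).1.aestronglyMeasurable)
      (Eventually.of_forall fun s => ae_of_all _ fun η => hC _) (integrable_const _)
      (ae_of_all _ fun η => hloc ω _ fun i => ?_)
    filter_upwards [eventually_ge_atTop {i}] with s hs
    exact merge_of_notMem (by simpa using hs) _ _
  have hlim : Tendsto (fun s : Finset I => ∫ ω, avg μ (s : Set I)ᶜ g ω ^ 2 ∂P) atTop
      (nhds (∫ ω, g ω ^ 2 ∂P)) := by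
    refine tendsto_integral_filter_of_dominated_convergence (fun _ => C ^ 2)
      (Eventually.of_forall fun s => (hg.avg μ _).pow.1.aestronglyMeasurable)
      (Eventually.of_forall fun s => ae_of_all _ fun ω => ?_) (integrable_const _)
      (ae_of_all _ fun ω => (havg ω).pow 2)
    rw [norm_pow, Real.norm_eq_abs]
    exact pow_le_pow_left₀ (abs_nonneg _) (abs_integral_le_of_le fun η => hC _) 2
  have hle : ∫ ω, g ω ^ 2 ∂P ≤ (∫ ω, g ω ∂P) ^ 2 + B :=
    le_of_tendsto' hlim fun s => (integral_sq_avg_compl_le μ ℓ hg W hW s).trans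
      (add_le_add_right (hB s) _)
  have e : ∀ ω, (g ω - ∫ ω, g ω ∂P) ^ 2 =
      g ω ^ 2 - 2 * (∫ ω, g ω ∂P) * g ω + (∫ ω, g ω ∂P) ^ 2 := fun ω => by ring
  have i1 := hg.pow.integrable P
  have i2 := hg.integrable P
  simp only [e]
  rw [integral_add (f := fun ω => _ - _) (i1.sub (i2.const_mul _)) (integrable_const _),
    integral_sub i1 (i2.const_mul _), integral_const_mul]
  simp only [integral_const, probReal_univ, smul_eq_mul, one_mul]
  nlinarith

end Averaging

set_option linter.unusedSectionVars false

/-! ### Additive functionals and hitting probabilities as first-step recursions. -/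

section WalkFunctionals

variable {V S : Type*} [AddCommGroup V] [MeasurableSpace V] [MeasurableSpace S]

/-- `∑_{k<m} E_x^ω β(ω_{X_k})` for the walk whose jumps from `x` have law `κ (ω x)`. -/
noncomputable def expSum (κ : Kernel S V) (β : S → ℝ) : ℕ → V → (V → S) → ℝ
  | 0, _, _ => 0
  | m + 1, x, ω => β (ω x) + ∫ y, expSum κ β m (x + y) ω ∂κ (ω x)

open Classical in
/-- The probability that the walk from `x` visits `T` before time `m`. -/
noncomputable def hitProb (κ : Kernel S V) (T : Set V) : ℕ → V → (V → S) → ℝ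
  | 0, _, _ => 0
  | m + 1, x, ω => if x ∈ T then 1 else ∫ y, hitProb κ T m (x + y) ω ∂κ (ω x)

/-- Uniformly bounded families of measurable functions of the environment. -/
def UnifBdd (G : V → (V → S) → ℝ) : Prop :=
  (∀ y, Measurable (G y)) ∧ ∃ C : ℝ, ∀ y ω, |G y ω| ≤ C

section Basic

variable [DiscreteMeasurableSpace V] {G : V → (V → S) → ℝ} {κ : Kernel S V}

lemma UnifBdd.bddMeas (hG : UnifBdd G) (y : V) : BddMeas (G y) :=
  ⟨hG.1 y, hG.2.imp fun _ h => h y⟩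

lemma UnifBdd.bddMeas_site (hG : UnifBdd G) (x : V) (ω : V → S) :
    BddMeas (fun y => G (x + y) ω) :=
  ⟨.of_discrete, hG.2.imp fun _ h y => h (x + y) ω⟩

lemma UnifBdd.joint [Countable V] (hG : UnifBdd G) (x : V) :
    BddMeas (fun p : (V → S) × V => G (x + p.2) p.1) :=
  ⟨measurable_from_prod_countable_left fun y => hG.1 (x + y), hG.2.imp fun _ h _ => h _ _⟩

lemma measurable_step [Countable V] [IsMarkovKernel κ] (hG : UnifBdd G) (x : V) :
    Measurable (fun ω : V → S => ∫ y, G (x + y) ω ∂κ (ω x)) :=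
  (BddMeas.integral_kernel (κ := κ.comap (fun ω : V → S => ω x) (measurable_pi_apply x))
    (hG.joint x)).1

/-- The jump law at `x` is untouched by resampling `A` because `x ∉ A`, so Fubini applies.
First-step analysis thus survives averaging, but only at sites outside the averaged region. -/
lemma avg_step [Countable V] [IsMarkovKernel κ] (μ : Measure S) [IsProbabilityMeasure μ]
    (hG : UnifBdd G) {A : Set V} {x : V} (hx : x ∉ A) (ω : V → S) :
    avg μ A (fun ω => ∫ y, G (x + y) ω ∂κ (ω x)) ω =
      ∫ y, avg μ A (G (x + y)) ω ∂κ (ω x) := by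
  simp only [avg, merge_of_notMem hx]
  refine integral_integral_swap ?_
  have h := (hG.joint x).comp (β := (V → S) × V) (h := fun p => (merge A p.1 ω, p.2))
    (((measurable_merge_left A ω).comp measurable_fst).prodMk measurable_snd)
  exact h.integrable _

variable {β : S → ℝ} {C : ℝ}

lemma abs_expSum_le [IsMarkovKernel κ] (hC : ∀ p, |β p| ≤ C) (m : ℕ) (x : V) (ω : V → S) :
    |expSum κ β m x ω| ≤ C * m := by
  induction m generalizing x with
  | zero => simp [expSum]
  | succ m ih =>
    refine (abs_add_le _ _).trans ?_
    have := abs_integral_le_of_le (P := κ (ω x)) fun y => ih (x + y)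
    push_cast
    linarith [hC (ω x)]

lemma unifBdd_expSum [Countable V] [IsMarkovKernel κ] (hβ : Measurable β) (hC : ∀ p, |β p| ≤ C)
    (m : ℕ) : UnifBdd (expSum (V := V) κ β m) := by
  refine ⟨?_, C * m, abs_expSum_le hC m⟩
  induction m with
  | zero => exact fun y => measurable_const
  | succ m ih =>
    exact fun y => (hβ.comp (measurable_pi_apply y)).add
      (measurable_step ⟨ih, C * m, abs_expSum_le hC m⟩ y)

lemma hitProb_nonneg (T : Set V) (m : ℕ) (x : V) (ω : V → S) : 0 ≤ hitProb κ T m x ω := by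
  induction m generalizing x with
  | zero => simp [hitProb]
  | succ m ih =>
    rw [hitProb]
    split_ifs
    · exact zero_le_one
    · exact integral_nonneg fun y => ih _

lemma abs_hitProb_le [IsMarkovKernel κ] (T : Set V) (m : ℕ) (x : V) (ω : V → S) :
    |hitProb κ T m x ω| ≤ 1 := by
  induction m generalizing x with
  | zero => simp [hitProb]
  | succ m ih =>
    rw [hitProb]
    split_ifs
    · simp
    · exact abs_integral_le_of_le fun y => ih (x + y)

lemma unifBdd_hitProb [Countable V] [IsMarkovKernel κ] (T : Set V) (m : ℕ) :
    UnifBdd (S := S) (hitProb κ T m) := by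
  refine ⟨?_, 1, abs_hitProb_le T m⟩
  induction m with
  | zero => exact fun y => measurable_const
  | succ m ih =>
    intro y
    by_cases hy : y ∈ T
    · simp only [hitProb, hy, if_true]; exact measurable_const
    · simp only [hitProb, hy, if_false]
      exact measurable_step ⟨ih, 1, abs_hitProb_le T m⟩ y

lemma hitProb_of_mem {T : Set V} {x : V} (hx : x ∈ T) (m : ℕ) (ω : V → S) :
    hitProb κ T (m + 1) x ω = 1 := by simp [hitProb, hx]

lemma hitProb_of_notMem {T : Set V} {x : V} (hx : x ∉ T) (m : ℕ) (ω : V → S) :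
    hitProb κ T (m + 1) x ω = ∫ y, hitProb κ T m (x + y) ω ∂κ (ω x) := by simp [hitProb, hx]

/-- Only `m` steps are made and each reads one site; dominated convergence takes care of the
infinitely many possible jumps. -/
lemma isLocal_expSum [Countable V] [IsMarkovKernel κ] (hC : ∀ p, |β p| ≤ C) (m : ℕ) (x : V) :
    IsLocal (expSum κ β m x) := by
  induction m generalizing x with
  | zero => exact fun ω u hu => by simp [expSum]
  | succ m ih =>
    intro ω u hu
    have h : Tendsto (fun s => β (ω x) + ∫ y, expSum κ β m (x + y) (u s) ∂κ (ω x)) atTop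
        (nhds (expSum κ β (m + 1) x ω)) := by
      refine Tendsto.const_add _ ?_
      exact tendsto_integral_filter_of_dominated_convergence (fun _ => C * m)
        (Eventually.of_forall fun s => Measurable.of_discrete.aestronglyMeasurable)
        (Eventually.of_forall fun s => ae_of_all _ fun y => abs_expSum_le hC m _ _)
        (integrable_const _) (ae_of_all _ fun y => ih (x + y) ω u hu)
    refine h.congr' ?_
    filter_upwards [hu x] with s hs
    rw [expSum, hs]

lemma expSum_shift (m : ℕ) (x a : V) (ω : V → S) :
    expSum κ β m (x + a) ω = expSum κ β m x (fun j => ω (j + a)) := by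
  induction m generalizing x with
  | zero => rfl
  | succ m ih =>
    simp only [expSum]
    congr 2
    funext y
    rw [← ih, add_right_comm]

lemma abs_expSum_succ_sub_le [Countable V] [IsMarkovKernel κ] (hβ : Measurable β)
    (hC : ∀ p, |β p| ≤ C) (m : ℕ) (x : V) (ω : V → S) :
    |expSum κ β (m + 1) x ω - expSum κ β m x ω| ≤ C := by
  induction m generalizing x with
  | zero => simpa [expSum] using hC (ω x)
  | succ m ih =>
    have e1 : expSum κ β (m + 1 + 1) x ω =
      β (ω x) + ∫ y, expSum κ β (m + 1) (x + y) ω ∂κ (ω x) := rfl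
    have e2 : expSum κ β (m + 1) x ω = β (ω x) + ∫ y, expSum κ β m (x + y) ω ∂κ (ω x) := rfl
    rw [e1, e2, add_sub_add_left_eq_sub, ← integral_sub]
    · exact abs_integral_le_of_le fun y => ih (x + y)
    · exact ((unifBdd_expSum hβ hC (m + 1)).bddMeas_site x ω).integrable _
    · exact ((unifBdd_expSum hβ hC m).bddMeas_site x ω).integrable _

end Basic

section Shift

variable (μ : Measure S) [IsProbabilityMeasure μ]

lemma map_shift (a : V) :
    (Measure.infinitePi fun _ : V => μ).map (fun ω j => ω (j + a)) =
      Measure.infinitePi fun _ : V => μ := by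
  have := Measure.infinitePi_map_piCongrLeft (fun _ : V => μ) (Equiv.addRight (-a))
  convert this using 2
  funext ω j
  obtain ⟨i, rfl⟩ := (Equiv.addRight (-a)).surjective j
  rw [MeasurableEquiv.coe_piCongrLeft, Equiv.piCongrLeft_apply_apply]
  simp

lemma avg_shift (a : V) (A : Set V) {g : (V → S) → ℝ} (hg : BddMeas g) (ω : V → S) :
    avg μ A (fun ω => g (fun j => ω (j + a))) ω =
      avg μ {j | j + a ∈ A} g (fun j => ω (j + a)) := by
  have e : ∀ η : V → S, (fun j => merge A η ω (j + a)) =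
      merge {j | j + a ∈ A} (fun j => η (j + a)) (fun j => ω (j + a)) := by
    intro η
    funext j
    by_cases hj : j + a ∈ A <;> simp [merge, hj]
  simp only [avg, e]
  conv_rhs => rw [← map_shift μ a]
  rw [integral_map (measurable_pi_iff.2 fun j => measurable_pi_apply (j + a)).aemeasurable
    (hg.merge _ _).1.aestronglyMeasurable]

end Shift

end WalkFunctionals

/-! ### A centre for bounded functions, within half the oscillation and 1-Lipschitz in the sup norm.
-/

section Midrange

variable {ι : Type*} [Nonempty ι] {f g : ι → ℝ} {C : ℝ}

/-- The midpoint of the range of a bounded function. -/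
noncomputable def midrange (f : ι → ℝ) : ℝ := ((⨆ i, f i) + ⨅ i, f i) / 2

lemma abs_sub_midrange_le (hf : ∃ B, ∀ i, |f i| ≤ B) (h : ∀ i j, |f i - f j| ≤ C) (i : ι) :
    |f i - midrange f| ≤ C / 2 := by
  obtain ⟨B, hB⟩ := hf
  have ha : BddAbove (Set.range f) := ⟨B, by rintro _ ⟨i, rfl⟩; exact (abs_le.1 (hB i)).2⟩
  have hb : BddBelow (Set.range f) := ⟨-B, by rintro _ ⟨i, rfl⟩; exact (abs_le.1 (hB i)).1⟩
  have h1 := le_ciSup ha i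
  have h2 := ciInf_le hb i
  have h3 : (⨆ j, f j) ≤ (⨅ j, f j) + C := by
    refine ciSup_le fun j => ?_
    have : f j - C ≤ ⨅ j, f j := le_ciInf fun k => by linarith [(abs_le.1 (h j k)).2]
    linarith
  rw [midrange, abs_le]
  constructor <;> linarith

lemma abs_midrange_sub_le (hf : ∃ B, ∀ i, |f i| ≤ B) (hg : ∃ B, ∀ i, |g i| ≤ B)
    (h : ∀ i, |f i - g i| ≤ C) : |midrange f - midrange g| ≤ C := by
  obtain ⟨B, hB⟩ := hf
  obtain ⟨D, hD⟩ := hg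
  have ha : BddAbove (Set.range f) := ⟨B, by rintro _ ⟨i, rfl⟩; exact (abs_le.1 (hB i)).2⟩
  have hb : BddBelow (Set.range f) := ⟨-B, by rintro _ ⟨i, rfl⟩; exact (abs_le.1 (hB i)).1⟩
  have ha' : BddAbove (Set.range g) := ⟨D, by rintro _ ⟨i, rfl⟩; exact (abs_le.1 (hD i)).2⟩
  have hb' : BddBelow (Set.range g) := ⟨-D, by rintro _ ⟨i, rfl⟩; exact (abs_le.1 (hD i)).1⟩
  have h1 : (⨆ i, f i) ≤ (⨆ i, g i) + C :=
    ciSup_le fun i => by linarith [(abs_le.1 (h i)).2, le_ciSup ha' i]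
  have h2 : (⨆ i, g i) ≤ (⨆ i, f i) + C :=
    ciSup_le fun i => by linarith [(abs_le.1 (h i)).1, le_ciSup ha i]
  have h3 : (⨅ i, f i) - C ≤ ⨅ i, g i :=
    le_ciInf fun i => by linarith [(abs_le.1 (h i)).2, ciInf_le hb i]
  have h4 : (⨅ i, g i) - C ≤ ⨅ i, f i :=
    le_ciInf fun i => by linarith [(abs_le.1 (h i)).1, ciInf_le hb' i]
  rw [midrange, midrange, abs_le]
  constructor <;> linarith

end Midrange

/-! ### Exponential supermartingales and the comparison principle. -/

section Comparison

variable {V S : Type*} [AddCommGroup V] [Countable V] [MeasurableSpace V]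
  [DiscreteMeasurableSpace V] [MeasurableSpace S]

/-- Two exponential supermartingale conditions on the level `ℓ` of a walk with jump laws `κ`. -/
structure UpwardDrift (κ : Kernel S V) (ℓ : V →+ ℤ) (s s' ρ : ℝ) : Prop where
  integrable : ∀ p, Integrable (fun y => Real.exp (-s * (ℓ y : ℝ))) (κ p)
  integral_le : ∀ p, ∫ y, Real.exp (-s * (ℓ y : ℝ)) ∂κ p ≤ 1
  integrable' : ∀ p, Integrable (fun y => Real.exp (-s' * (ℓ y : ℝ))) (κ p)
  integral_le' : ∀ p, ∫ y, Real.exp (-s' * (ℓ y : ℝ)) ∂κ p ≤ ρ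
  pos : 0 < s'
  le : s' ≤ s
  lt_one : ρ < 1

variable {κ : Kernel S V} [IsMarkovKernel κ] {ℓ : V →+ ℤ} {s s' ρ : ℝ} {β : S → ℝ} {C : ℝ}

lemma exp_level_add (ℓ : V →+ ℤ) (s c : ℝ) (x y : V) :
    Real.exp (-s * ((ℓ (x + y) : ℝ) - c)) =
      Real.exp (-s * ((ℓ x : ℝ) - c)) * Real.exp (-s * (ℓ y : ℝ)) := by
  rw [← Real.exp_add]
  congr 1
  push_cast [map_add]
  ring

namespace UpwardDrift

lemma integrable_exp (h : UpwardDrift κ ℓ s s' ρ) (c : ℝ) (p : S) (x : V) :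
    Integrable (fun y => Real.exp (-s * ((ℓ (x + y) : ℝ) - c))) (κ p) := by
  simp only [exp_level_add]
  exact (h.integrable p).const_mul _

lemma integral_exp_le (h : UpwardDrift κ ℓ s s' ρ) (c : ℝ) (p : S) (x : V) :
    ∫ y, Real.exp (-s * ((ℓ (x + y) : ℝ) - c)) ∂κ p ≤ Real.exp (-s * ((ℓ x : ℝ) - c)) := by
  simp only [exp_level_add]
  rw [integral_const_mul]
  exact mul_le_of_le_one_right (Real.exp_pos _).le (h.integral_le p)

lemma integrable_exp' (h : UpwardDrift κ ℓ s s' ρ) (c : ℝ) (p : S) (x : V) :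
    Integrable (fun y => Real.exp (-s' * ((ℓ (x + y) : ℝ) - c))) (κ p) := by
  simp only [exp_level_add]
  exact (h.integrable' p).const_mul _

lemma integral_exp_le' (h : UpwardDrift κ ℓ s s' ρ) (c : ℝ) (p : S) (x : V) :
    ∫ y, Real.exp (-s' * ((ℓ (x + y) : ℝ) - c)) ∂κ p ≤ ρ * Real.exp (-s' * ((ℓ x : ℝ) - c)) := by
  simp only [exp_level_add]
  rw [integral_const_mul, mul_comm]
  exact mul_le_mul_of_nonneg_right (h.integral_le' p) (Real.exp_pos _).le

/-- The exponential is a supersolution of the recursion for `hitProb` and is at least 1 on `T`. This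
is the backtracking estimate. -/
lemma hitProb_le_exp (h : UpwardDrift κ ℓ s s' ρ) {T : Set V} {c : ℝ}
    (hT : ∀ x ∈ T, (ℓ x : ℝ) ≤ c) (m : ℕ) (x : V) (ω : V → S) :
    hitProb κ T m x ω ≤ Real.exp (-s * ((ℓ x : ℝ) - c)) := by
  have hs : 0 ≤ s := h.pos.le.trans h.le
  induction m generalizing x with
  | zero => exact (Real.exp_pos _).le
  | succ m ih =>
    by_cases hx : x ∈ T
    · rw [hitProb_of_mem hx]
      refine Real.one_le_exp ?_
      nlinarith [hT x hx]
    · rw [hitProb_of_notMem hx]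
      exact (integral_mono (((unifBdd_hitProb T m).bddMeas_site x ω).integrable _)
        (h.integrable_exp c _ x) fun y => ih (x + y)).trans (h.integral_exp_le c _ x)

end UpwardDrift

/-- Before visiting `T` the walks in `ω` and `ω'` have the same jump laws and rewards; once in `T`
the trivial bound `2 * C * m` is used. -/
lemma abs_expSum_sub_le_hitProb (hβ : Measurable β) (hC : ∀ p, |β p| ≤ C) {T : Set V}
    {ω ω' : V → S} (hT : ∀ x ∉ T, ω x = ω' x) (m : ℕ) (x : V) :
    |expSum κ β m x ω - expSum κ β m x ω'| ≤ 2 * C * m * hitProb κ T m x ω := by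
  have hC0 : 0 ≤ C := (abs_nonneg _).trans (hC (ω 0))
  induction m generalizing x with
  | zero => simp [expSum]
  | succ m ih =>
    by_cases hx : x ∈ T
    · rw [hitProb_of_mem hx, mul_one]
      have := (abs_sub (expSum κ β (m + 1) x ω) (expSum κ β (m + 1) x ω')).trans
        (add_le_add (abs_expSum_le hC _ _ _) (abs_expSum_le hC _ _ _))
      linarith
    · have hm := unifBdd_expSum (V := V) (κ := κ) hβ hC m
      have hH : BddMeas fun y => 2 * C * m * hitProb κ T m (x + y) ω :=
        (BddMeas.const _).mul ((unifBdd_hitProb T m).bddMeas_site x ω)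
      rw [hitProb_of_notMem hx, expSum, expSum, ← hT x hx, add_sub_add_left_eq_sub,
        ← integral_sub ((hm.bddMeas_site x ω).integrable _) ((hm.bddMeas_site x ω').integrable _)]
      refine (abs_integral_le_integral_abs).trans ((integral_mono
        (((hm.bddMeas_site x ω).sub (hm.bddMeas_site x ω')).integrable _).abs
        (hH.integrable _) fun y => ih (x + y)).trans ?_)
      rw [integral_const_mul]
      refine mul_le_mul_of_nonneg_right ?_ (integral_nonneg fun y => hitProb_nonneg _ _ _ _)
      push_cast
      nlinarith

variable (μ : Measure S) [IsProbabilityMeasure μ]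

lemma avg_expSum_succ (hβ : Measurable β) (hC : ∀ p, |β p| ≤ C) {A : Set V} {x : V} (hx : x ∉ A)
    (m : ℕ) (ω : V → S) :
    avg μ A (expSum κ β (m + 1) x) ω =
      β (ω x) + ∫ y, avg μ A (expSum κ β m (x + y)) ω ∂κ (ω x) := by
  have hm := unifBdd_expSum (V := V) (κ := κ) hβ hC m
  rw [← avg_step μ hm hx]
  simp only [avg, expSum]
  rw [integral_add]
  · simp [merge_of_notMem hx]
  · simp [merge_of_notMem hx]
  · have hb : BddMeas fun ω : V → S => ∫ y, expSum κ β m (x + y) ω ∂κ (ω x) :=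
      ⟨measurable_step hm x, C * m, fun ω =>
        abs_integral_le_of_le fun y => abs_expSum_le hC m (x + y) ω⟩
    exact (hb.merge A ω).integrable _

lemma unifBdd_avg {G : V → (V → S) → ℝ} (hG : UnifBdd G) (A : Set V) :
    UnifBdd (fun y => avg μ A (G y)) :=
  ⟨fun y => ((hG.bddMeas y).avg μ A).1, hG.2.imp fun _ h y _ => abs_integral_le_of_le fun _ => h y _⟩

/-- Comparison principle: the difference of averaged additive functionals in two environments that
agree off `T` is dominated by any supersolution that dominates it on `T` and on the averaged
region. -/
lemma abs_avg_sub_le_of_supersolution (hβ : Measurable β) (hC : ∀ p, |β p| ≤ C) {T W : Set V}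
    {ω ω' : V → S} (hT : ∀ x ∉ T, ω x = ω' x) (h : ℕ → V → ℝ) (M : ℕ)
    (hint : ∀ m x, Integrable (fun y => h m (x + y)) (κ (ω x)))
    (h0 : ∀ x, 0 ≤ h 0 x)
    (hbd : ∀ m < M, ∀ x ∈ T ∪ W,
      |avg μ W (expSum κ β m x) ω - avg μ W (expSum κ β m x) ω'| ≤ h m x)
    (hstep : ∀ m x, x ∉ T ∪ W → ∫ y, h m (x + y) ∂κ (ω x) ≤ h (m + 1) x) :
    ∀ m ≤ M, ∀ x ∉ T ∪ W,
      |avg μ W (expSum κ β m x) ω - avg μ W (expSum κ β m x) ω'| ≤ h m x := by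
  intro m
  induction m with
  | zero => intro _ x _; simpa [avg, expSum] using h0 x
  | succ m ih =>
    intro hm x hx
    have hxT : x ∉ T := fun hh => hx (Or.inl hh)
    have hxW : x ∉ W := fun hh => hx (Or.inr hh)
    have hub := unifBdd_avg μ (unifBdd_expSum (V := V) (κ := κ) hβ hC m) W
    rw [avg_expSum_succ μ hβ hC hxW, avg_expSum_succ μ hβ hC hxW, ← hT x hxT,
      add_sub_add_left_eq_sub, ← integral_sub ((hub.bddMeas_site x ω).integrable _)
        ((hub.bddMeas_site x ω').integrable _)]
    refine (abs_integral_le_integral_abs).trans ((integral_mono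
      (((hub.bddMeas_site x ω).sub (hub.bddMeas_site x ω')).integrable _).abs
      (hint m x) fun y => ?_).trans (hstep m x hx))
    by_cases hy : x + y ∈ T ∪ W
    · exact hbd m hm _ hy
    · exact ih (by omega) _ hy

end Comparison

/-! ### Influence of the environment behind the walk, influence of one site, and the variance bound.
-/

section Oscillation

variable {V S : Type*} [AddCommGroup V] [Countable V] [MeasurableSpace V]
  [DiscreteMeasurableSpace V] [MeasurableSpace S]

/-- The sites of level at least `a`. -/
def upper (ℓ : V →+ ℤ) (a : ℤ) : Set V := {j | a ≤ ℓ j}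

/-- The averaged additive functional of the walk from the origin, over the environment at
nonnegative levels. -/
noncomputable def upperMean (μ : Measure S) (κ : Kernel S V) (ℓ : V →+ ℤ) (β : S → ℝ) (m : ℕ)
    (ω : V → S) : ℝ :=
  avg μ (upper ℓ 0) (expSum κ β m 0) ω

/-- The influence of the environment below the starting level is at most `O` up to time `M`. -/
def OscLE (μ : Measure S) (κ : Kernel S V) (ℓ : V →+ ℤ) (β : S → ℝ) (M : ℕ) (O : ℝ) : Prop :=
  ∀ m ≤ M, ∀ ω ω', |upperMean μ κ ℓ β m ω - upperMean μ κ ℓ β m ω'| ≤ O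

variable {κ : Kernel S V} [IsMarkovKernel κ] {ℓ : V →+ ℤ} {s s' ρ : ℝ} {β : S → ℝ} {C : ℝ}
  (μ : Measure S) [IsProbabilityMeasure μ]

lemma abs_upperMean_le (hC : ∀ p, |β p| ≤ C) (m : ℕ) (ω : V → S) :
    |upperMean μ κ ℓ β m ω| ≤ C * m :=
  abs_integral_le_of_le fun _ => abs_expSum_le hC m _ _

lemma abs_upperMean_sub_midrange_le (hC : ∀ p, |β p| ≤ C) {M : ℕ} {O : ℝ}
    (hO : OscLE μ κ ℓ β M O) {m : ℕ} (hm : m ≤ M) (ω : V → S) :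
    |upperMean μ κ ℓ β m ω - midrange (upperMean μ κ ℓ β m)| ≤ O / 2 :=
  have : Nonempty (V → S) := ⟨ω⟩
  abs_sub_midrange_le ⟨_, abs_upperMean_le μ hC m⟩ (hO m hm) ω

/-- The reference constant moves by at most `C` when the horizon grows by one, so a first-step
argument can follow it from `m` to `m + 1`. -/
lemma abs_midrange_succ_sub_le [Nonempty S] (hβ : Measurable β) (hC : ∀ p, |β p| ≤ C) (m : ℕ) :
    |midrange (upperMean μ κ ℓ β (m + 1)) - midrange (upperMean μ κ ℓ β m)| ≤ C := by
  refine abs_midrange_sub_le ⟨_, abs_upperMean_le μ hC _⟩ ⟨_, abs_upperMean_le μ hC _⟩ fun ω => ?_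
  rw [upperMean, upperMean, ← avg_sub μ ((unifBdd_expSum hβ hC _).bddMeas 0)
    ((unifBdd_expSum hβ hC _).bddMeas 0)]
  exact abs_integral_le_of_le fun η => abs_expSum_succ_sub_le hβ hC m 0 _

/-- The comparison constant depends neither on `ω` nor on `y`. From a site at or above `a`, a
translation reduces to `upperMean`, averaged further, whence `O / 2`. Below `a` each step costs at
most `2 * C`: `C` for the reward and `C` for the shift of the midrange. The exponential pays for the
climb because one step contracts its mean by `ρ`, and `2 * C / (1 - ρ)` is the constant that
balances this. -/
lemma abs_avg_upper_sub_midrange_le (h : UpwardDrift κ ℓ s s' ρ) (hβ : Measurable β)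
    (hC : ∀ p, |β p| ≤ C) {M : ℕ} {O : ℝ} (hO : OscLE μ κ ℓ β M O) {m : ℕ} (hm : m ≤ M)
    (a : ℤ) (y : V) (ω : V → S) :
    |avg μ (upper ℓ a) (expSum κ β m y) ω - midrange (upperMean μ κ ℓ β m)| ≤
      O / 2 + 2 * C / (1 - ρ) * Real.exp (-s' * ((ℓ y : ℝ) - a)) := by
  have hC0 : 0 ≤ C := (abs_nonneg _).trans (hC (ω 0))
  have hρ : 0 < 1 - ρ := by linarith [h.lt_one]
  have : Nonempty S := ⟨ω 0⟩
  have hO0 : 0 ≤ O := (abs_nonneg _).trans (hO 0 (Nat.zero_le _) ω ω)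
  set K := 2 * C / (1 - ρ) with hK
  have hK0 : 0 ≤ K := by positivity
  have hK1 : K * (1 - ρ) = 2 * C := by rw [hK]; field_simp
  induction m generalizing y with
  | zero =>
    have e : upperMean μ κ ℓ β 0 = fun _ => 0 := by
      funext ω; simp [upperMean, avg, expSum]
    rw [e]
    simp only [avg, expSum, midrange, integral_zero, ciSup_const, ciInf_const]
    simp only [add_zero, zero_div, sub_zero, abs_zero]
    positivity
  | succ m ih =>
    by_cases hy : a ≤ ℓ y
    · have e : expSum κ β (m + 1) y = fun ω => expSum κ β (m + 1) 0 (fun j => ω (j + y)) := by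
        funext ω; rw [← expSum_shift, zero_add]
      have hb := (unifBdd_expSum (V := V) (κ := κ) hβ hC (m + 1)).bddMeas 0
      have hsub : upper ℓ 0 ⊆ {j | j + y ∈ upper ℓ a} := by
        intro j hj
        simp only [upper, Set.mem_ofPred_eq, map_add] at hj ⊢
        omega
      rw [e, avg_shift μ y _ hb, ← avg_avg_of_subset μ hsub hb]
      have hF := hb.avg μ (upper ℓ 0)
      have : |avg μ {j | j + y ∈ upper ℓ a} (fun ω => avg μ (upper ℓ 0) (expSum κ β (m + 1) 0) ω -
          midrange (upperMean μ κ ℓ β (m + 1))) (fun j => ω (j + y))| ≤ O / 2 :=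
        abs_integral_le_of_le fun η => abs_upperMean_sub_midrange_le μ hC hO hm _
      rw [avg_sub μ hF (BddMeas.const _)] at this
      have hc : avg μ {j | j + y ∈ upper ℓ a} (fun _ : V → S =>
          midrange (upperMean μ κ ℓ β (m + 1))) (fun j => ω (j + y)) =
          midrange (upperMean μ κ ℓ β (m + 1)) := by simp [avg]
      rw [hc] at this
      have := Real.exp_pos (-s' * ((ℓ y : ℝ) - a))
      have : 0 ≤ K * Real.exp (-s' * ((ℓ y : ℝ) - a)) := by positivity
      linarith
    · have hub := unifBdd_avg μ (unifBdd_expSum (V := V) (κ := κ) hβ hC m) (upper ℓ a)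
      set c := midrange (upperMean μ κ ℓ β m) with hc
      set c' := midrange (upperMean μ κ ℓ β (m + 1)) with hc'
      have hcc : |c' - c| ≤ C := abs_midrange_succ_sub_le μ hβ hC m
      have hint := (hub.bddMeas_site y ω).sub (BddMeas.const c)
      have hI : |∫ z, avg μ (upper ℓ a) (expSum κ β m (y + z)) ω ∂κ (ω y) - c| ≤
          O / 2 + K * (ρ * Real.exp (-s' * ((ℓ y : ℝ) - a))) := by
        have e : ∫ z, (avg μ (upper ℓ a) (expSum κ β m (y + z)) ω - c) ∂κ (ω y) =
            ∫ z, avg μ (upper ℓ a) (expSum κ β m (y + z)) ω ∂κ (ω y) - c := by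
          rw [integral_sub ((hub.bddMeas_site y ω).integrable _) (integrable_const _)]
          simp
        rw [← e]
        refine (abs_integral_le_integral_abs).trans ((integral_mono (hint.integrable _).abs
          ((integrable_const (O / 2)).add ((h.integrable_exp' a (ω y) y).const_mul K))
          fun z => ih (by omega) (y + z)).trans ?_)
        rw [integral_add' (integrable_const _) ((h.integrable_exp' a (ω y) y).const_mul K),
          integral_const_mul]
        simp only [integral_const, probReal_univ, smul_eq_mul, one_mul]
        gcongr
        exact h.integral_exp_le' a _ y
      rw [avg_expSum_succ μ hβ hC (A := upper ℓ a) (x := y) hy]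
      -- Below `a` the exponential is at least 1, so the gain `K * (1 - ρ) = 2 * C` per step covers
      -- the cost.
      have h1 : 1 ≤ Real.exp (-s' * ((ℓ y : ℝ) - a)) := by
        refine Real.one_le_exp ?_
        have : (ℓ y : ℝ) ≤ a := by exact_mod_cast (not_le.1 hy).le
        nlinarith [h.pos]
      have h2 : 2 * C ≤ K * (1 - ρ) * Real.exp (-s' * ((ℓ y : ℝ) - a)) := by
        rw [hK1]; nlinarith
      have h3 := hC (ω y)
      rw [abs_le] at h3 hI hcc ⊢
      constructor <;> nlinarith

/-- The bound for the influence of the environment below level `a` on the walk from `y`. -/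
lemma abs_avg_upper_sub_le (h : UpwardDrift κ ℓ s s' ρ) (hβ : Measurable β)
    (hC : ∀ p, |β p| ≤ C) {M : ℕ} {O : ℝ} (hO : OscLE μ κ ℓ β M O) {m : ℕ} (hm : m ≤ M)
    (a : ℤ) (y : V) (ω ω' : V → S) :
    |avg μ (upper ℓ a) (expSum κ β m y) ω - avg μ (upper ℓ a) (expSum κ β m y) ω'| ≤
      O + 4 * C / (1 - ρ) * Real.exp (-s' * ((ℓ y : ℝ) - a)) := by
  have h1 := abs_avg_upper_sub_midrange_le μ h hβ hC hO hm a y ω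
  have h2 := abs_avg_upper_sub_midrange_le μ h hβ hC hO hm a y ω'
  have e : 4 * C / (1 - ρ) = 2 * (2 * C / (1 - ρ)) := by ring
  rw [e]
  rw [abs_le] at h1 h2 ⊢
  constructor <;> linarith

/-- The contribution of a slab of thickness `L` to the oscillation. -/
noncomputable def slabCost (s' ρ C : ℝ) (L : ℕ) : ℝ :=
  4 * C / (1 - ρ) * Real.exp (s' * (L + 1))

/-- The bound on the oscillation up to time `n` obtained from slabs of thickness `L`. -/
noncomputable def oscBound (s s' ρ C : ℝ) (n L : ℕ) : ℝ :=
  (2 * C * n * Real.exp (-s * L) + slabCost s' ρ C L) / (1 - Real.exp (-s))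

lemma abs_avg_expSum_sub_le_of_far (h : UpwardDrift κ ℓ s s' ρ) (hβ : Measurable β)
    (hC : ∀ p, |β p| ≤ C) {T : Set V} {ω ω' : V → S} (hT : ∀ x ∉ T, ω x = ω' x) {c : ℝ}
    (hc : ∀ x ∈ T, (ℓ x : ℝ) ≤ c) {n m : ℕ} (hm : m ≤ n) {L : ℕ} {x : V} (hx : c + L ≤ ℓ x)
    (W : Set V) :
    |avg μ W (expSum κ β m x) ω - avg μ W (expSum κ β m x) ω'| ≤
      2 * C * n * Real.exp (-s * L) := by
  have hC0 : 0 ≤ C := (abs_nonneg _).trans (hC (ω 0))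
  have hs : 0 < s := h.pos.trans_le h.le
  have hb := unifBdd_expSum (V := V) (κ := κ) hβ hC m
  rw [avg, avg, ← integral_sub (((hb.bddMeas x).merge W ω).integrable _)
    (((hb.bddMeas x).merge W ω').integrable _)]
  refine abs_integral_le_of_le fun η => ?_
  have hag : ∀ x ∉ T, merge W η ω x = merge W η ω' x := by
    intro x hx
    by_cases hW : x ∈ W
    · simp [merge_of_mem hW]
    · simp [merge_of_notMem hW, hT x hx]
  refine (abs_expSum_sub_le_hitProb hβ hC hag m x).trans ?_
  have h1 : hitProb κ T m x (merge W η ω) ≤ Real.exp (-s * L) :=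
    (h.hitProb_le_exp hc m x _).trans (Real.exp_le_exp.2 (by nlinarith))
  have h2 : (m : ℝ) ≤ n := by exact_mod_cast hm
  have h3 := Real.exp_pos (-s * L)
  calc 2 * C * m * hitProb κ T m x (merge W η ω) ≤ 2 * C * m * Real.exp (-s * L) := by gcongr
    _ ≤ _ := by gcongr

/-- Stop the walk on leaving the slab of levels in `[0, L)`. From an exit below, levels at least `L`
are still averaged, so the bound for horizon `M` applies at the price of the climb; from an exit
above, a return to negative levels is unlikely. Both are dominated by `τ + B * exp (-s * (ℓ x +
1))`, whose value at the origin carries the factor `exp (-s)`. This contraction keeps the iterates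
bounded. -/
lemma oscLE_succ (h : UpwardDrift κ ℓ s s' ρ) (hβ : Measurable β) (hC : ∀ p, |β p| ≤ C)
    {M n L : ℕ} (hMn : M < n) (hL : 1 ≤ L) {O : ℝ} (hO : OscLE μ κ ℓ β M O) (ω ω' : V → S) :
    |upperMean μ κ ℓ β (M + 1) ω - upperMean μ κ ℓ β (M + 1) ω'| ≤
      2 * C * n * Real.exp (-s * L) + (O + slabCost s' ρ C L) * Real.exp (-s) := by
  have hC0 : 0 ≤ C := (abs_nonneg _).trans (hC (ω 0))
  have hs : 0 < s := h.pos.trans_le h.le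
  have hρ : 0 < 1 - ρ := by linarith [h.lt_one]
  have hO0 : 0 ≤ O := (abs_nonneg _).trans (hO 0 (Nat.zero_le _) ω ω)
  set τ := 2 * C * n * Real.exp (-s * L) with hτ
  have hτ0 : 0 ≤ τ := by positivity
  have hK0 : 0 ≤ 4 * C / (1 - ρ) := by positivity
  set B := O + slabCost s' ρ C L with hB
  have hB0 : 0 ≤ B := add_nonneg hO0 (mul_nonneg hK0 (Real.exp_pos _).le)
  set T : Set V := (upper ℓ 0)ᶜ with hT
  set W : Set V := upper ℓ L with hW
  have hWU : W ⊆ upper ℓ 0 := fun j hj => le_trans (Int.natCast_nonneg L) hj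
  have hb := (unifBdd_expSum (V := V) (κ := κ) hβ hC (M + 1)).bddMeas 0
  have hbW := hb.avg μ W
  rw [upperMean, upperMean, ← avg_avg_of_subset μ hWU hb, ← avg_avg_of_subset μ hWU hb,
    avg, avg, ← integral_sub ((hbW.merge _ ω).integrable _) ((hbW.merge _ ω').integrable _)]
  refine abs_integral_le_of_le fun η => ?_
  have hag : ∀ x ∉ T, merge (upper ℓ 0) η ω x = merge (upper ℓ 0) η ω' x := by
    intro x hx
    have hx' : x ∈ upper ℓ 0 := not_not.1 hx
    simp [merge_of_mem hx']
  have hTl : ∀ x ∈ T, ℓ x ≤ -1 := by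
    intro x hx
    have : ¬ (0 ≤ ℓ x) := hx
    omega
  have hint : ∀ (c : ℝ) (x : V) (p : S), Integrable
      (fun y => τ + B * Real.exp (-s * ((ℓ (x + y) : ℝ) - c))) (κ p) := fun c x p =>
    (integrable_const _).add ((h.integrable_exp c p x).const_mul B)
  have h00 : (0 : V) ∉ T ∪ W := by
    simp only [hT, hW, upper, Set.mem_union, Set.mem_compl_iff, Set.mem_ofPred_eq, map_zero]
    omega
  have key := abs_avg_sub_le_of_supersolution (κ := κ) (W := W) μ hβ hC hag
    (fun _ x => τ + B * Real.exp (-s * ((ℓ x : ℝ) - (-1)))) (M + 1) (fun m x => hint _ x _)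
    (fun x => by positivity) ?_ ?_ (M + 1) le_rfl 0 h00
  · refine key.trans ?_
    simp
  · intro m hm x hx
    rcases hx with hx | hx
    · have h1 := abs_avg_upper_sub_le μ h hβ hC hO (Nat.lt_succ_iff.1 hm) L x
        (merge (upper ℓ 0) η ω) (merge (upper ℓ 0) η ω')
      refine h1.trans ?_
      have hx1 : (ℓ x : ℝ) ≤ -1 := by exact_mod_cast hTl x hx
      -- Since `ℓ x + 1 ≤ 0` and `s' ≤ s`, the climbing cost at rate `s'` is dominated by the
      -- supersolution at rate `s`.
      have e1 : Real.exp (-s' * ((ℓ x : ℝ) - (L : ℤ))) ≤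
          Real.exp (s' * (L + 1)) * Real.exp (-s * ((ℓ x : ℝ) - (-1))) := by
        rw [← Real.exp_add]
        refine Real.exp_le_exp.2 ?_
        push_cast
        nlinarith [h.le]
      have e2 : 1 ≤ Real.exp (-s * ((ℓ x : ℝ) - (-1))) := Real.one_le_exp (by nlinarith)
      have e3 : O ≤ O * Real.exp (-s * ((ℓ x : ℝ) - (-1))) := le_mul_of_one_le_right hO0 e2
      have e4 := mul_le_mul_of_nonneg_left e1 hK0
      rw [hB, slabCost]
      nlinarith
    · have hx1 : (-1 : ℝ) + (L : ℕ) ≤ ℓ x := by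
        have : ((L : ℤ) : ℝ) ≤ ℓ x := by exact_mod_cast hx
        push_cast at this
        linarith
      refine (abs_avg_expSum_sub_le_of_far μ h hβ hC hag (c := -1)
        (fun x hx => by exact_mod_cast hTl x hx) (by omega : m ≤ n) hx1 W).trans ?_
      have : 0 ≤ B * Real.exp (-s * ((ℓ x : ℝ) - (-1))) := by positivity
      linarith
  · intro m x hx
    rw [integral_add (f := fun _ => τ) (integrable_const _)
      ((h.integrable_exp _ _ x).const_mul B), integral_const_mul B]
    simp only [integral_const, probReal_univ, smul_eq_mul, one_mul]
    gcongr
    exact h.integral_exp_le _ _ x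

/-- The map from `O` to the bound of `oscLE_succ` sends `oscBound` to a value at most `oscBound`, so
induction on the horizon never leaves it. -/
lemma oscLE_oscBound (h : UpwardDrift κ ℓ s s' ρ) (hβ : Measurable β) (hC : ∀ p, |β p| ≤ C)
    {n L : ℕ} (hL : 1 ≤ L) : OscLE μ κ ℓ β n (oscBound s s' ρ C n L) := by
  have hs : 0 < s := h.pos.trans_le h.le
  have hρ : 0 < 1 - ρ := by linarith [h.lt_one]
  have he : 0 < 1 - Real.exp (-s) := by
    have : Real.exp (-s) < 1 := Real.exp_lt_one_iff.2 (by linarith)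
    linarith
  suffices ∀ M ≤ n, OscLE μ κ ℓ β M (oscBound s s' ρ C n L) from this n le_rfl
  intro M
  induction M with
  | zero =>
    intro _ m hm ω ω'
    have hC0 : 0 ≤ C := (abs_nonneg _).trans (hC (ω 0))
    obtain rfl : m = 0 := by omega
    have e : ∀ ω : V → S, upperMean μ κ ℓ β 0 ω = 0 := by
      intro ω; simp [upperMean, avg, expSum]
    rw [e, e, sub_zero, abs_zero, oscBound, slabCost]
    positivity
  | succ M ih =>
    intro hM m hm ω ω'
    have hO := ih (by omega)
    rcases Nat.lt_succ_iff_lt_or_eq.1 (Nat.lt_succ_of_le hm) with hlt | rfl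
    · exact hO m (by omega) ω ω'
    · refine (oscLE_succ μ h hβ hC (by omega : M < n) hL hO ω ω').trans ?_
      have hC0 : 0 ≤ C := (abs_nonneg _).trans (hC (ω 0))
      have hK : 0 ≤ slabCost s' ρ C L := by rw [slabCost]; positivity
      have e : oscBound s s' ρ C n L * (1 - Real.exp (-s)) =
          2 * C * n * Real.exp (-s * L) + slabCost s' ρ C L := by
        rw [oscBound]; field_simp
      nlinarith

/-- The influence of the environment at a single site `z` on the walk is controlled by the
probability of visiting `z`. -/
lemma abs_avg_sub_le_site (h : UpwardDrift κ ℓ s s' ρ) (hβ : Measurable β) (hC : ∀ p, |β p| ≤ C)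
    {n L : ℕ} (hL : 1 ≤ L) (z x : V) {ω ω' : V → S} (hag : ∀ x ∉ ({z} : Set V), ω x = ω' x) :
    |avg μ (upper ℓ (ℓ z + 1 + L)) (expSum κ β n x) ω -
      avg μ (upper ℓ (ℓ z + 1 + L)) (expSum κ β n x) ω'| ≤
      (oscBound s s' ρ C n L + slabCost s' ρ C L) *
        avg μ (upper ℓ (ℓ z + 1 + L)) (hitProb κ {z} n x) ω +
      2 * C * n * Real.exp (-s * L / 2) *
        avg μ (upper ℓ (ℓ z + 1 + L)) (fun ω => √(hitProb κ {z} n x ω)) ω := by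
  have hC0 : 0 ≤ C := (abs_nonneg _).trans (hC (ω 0))
  have hs : 0 < s := h.pos.trans_le h.le
  have hρ : 0 < 1 - ρ := by linarith [h.lt_one]
  have hO := oscLE_oscBound μ h hβ hC (n := n) hL
  have hO0 : 0 ≤ oscBound s s' ρ C n L := (abs_nonneg _).trans (hO 0 (Nat.zero_le _) ω ω)
  have hK0 : 0 ≤ slabCost s' ρ C L := by rw [slabCost]; positivity
  set W := upper ℓ (ℓ z + 1 + L) with hW
  set B := oscBound s s' ρ C n L + slabCost s' ρ C L with hB
  have hB0 : 0 ≤ B := add_nonneg hO0 hK0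
  set τ := 2 * C * n * Real.exp (-s * L / 2) with hτ
  have hτ0 : 0 ≤ τ := by positivity
  have hH : ∀ m, UnifBdd (hitProb (S := S) κ {z} m) := fun m => unifBdd_hitProb _ m
  have hH' : ∀ m, UnifBdd (fun x (ω : V → S) => √(hitProb κ {z} m x ω)) := fun m =>
    ⟨fun x => ((hH m).1 x).sqrt, 1, fun x ω => by
      rw [abs_of_nonneg (Real.sqrt_nonneg _), Real.sqrt_le_one]
      exact (le_abs_self _).trans (abs_hitProb_le _ _ _ _)⟩
  have hA0 : ∀ m x, 0 ≤ avg μ W (hitProb κ {z} m x) ω := fun m x =>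
    integral_nonneg fun η => hitProb_nonneg _ _ _ _
  have hA0' : ∀ m x, 0 ≤ avg μ W (fun ω => √(hitProb κ {z} m x ω)) ω := fun m x =>
    integral_nonneg fun η => Real.sqrt_nonneg _
  have hbd : ∀ m ≤ n, ∀ x ∈ ({z} ∪ W : Set V),
      |avg μ W (expSum κ β m x) ω - avg μ W (expSum κ β m x) ω'| ≤
        B * avg μ W (hitProb κ {z} m x) ω + τ * avg μ W (fun ω => √(hitProb κ {z} m x ω)) ω := by
    intro m hm x hx
    rcases hx with hx | hx
    -- At horizon 0 `hitProb` vanishes even at `z`, but so does `expSum`.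
    · rcases m with _ | m
      · have := hA0 0 x
        have := hA0' 0 x
        simp only [expSum, avg, integral_zero, sub_zero, abs_zero]
        positivity
      · have e : avg μ W (hitProb κ {z} (m + 1) x) ω = 1 := by
          simp [avg, hitProb_of_mem hx]
        have hx' : x = z := hx
        have h1 := abs_avg_upper_sub_le μ h hβ hC hO hm (ℓ z + 1 + L) x ω ω'
        have h2 := mul_nonneg hτ0 (hA0' (m + 1) x)
        have e2 : Real.exp (-s' * ((ℓ x : ℝ) - ((ℓ z + 1 + L : ℤ) : ℝ))) =
            Real.exp (s' * (L + 1)) := by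
          rw [hx']; congr 1; push_cast; ring
        rw [e2] at h1
        rw [e, mul_one, hB, slabCost]
        linarith
    · have hb := (unifBdd_expSum (V := V) (κ := κ) hβ hC m).bddMeas x
      rw [avg, avg, ← integral_sub ((hb.merge W ω).integrable _) ((hb.merge W ω').integrable _)]
      have hS := ((hH' m).bddMeas x).merge W ω
      -- One factor `√hitProb` is spent on the backtracking bound `exp (-s * L / 2)`. The other is
      -- kept: its square is summable over `z`, which a bound uniform in `z` would not be.
      have hle : ∀ η, |expSum κ β m x (merge W η ω) - expSum κ β m x (merge W η ω')| ≤
          τ * √(hitProb κ {z} m x (merge W η ω)) := by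
        intro η
        have hag' : ∀ x ∉ ({z} : Set V), merge W η ω x = merge W η ω' x := by
          intro x hx
          by_cases hxW : x ∈ W
          · simp [merge_of_mem hxW]
          · simp [merge_of_notMem hxW, hag x hx]
        refine (abs_expSum_sub_le_hitProb hβ hC hag' m x).trans ?_
        have hn := hitProb_nonneg (κ := κ) {z} m x (merge W η ω)
        have hx1 : (ℓ z : ℝ) + L ≤ ℓ x := by
          have : ((ℓ z + 1 + L : ℤ) : ℝ) ≤ ℓ x := by exact_mod_cast hx
          push_cast at this
          linarith
        have h1 : hitProb κ {z} m x (merge W η ω) ≤ Real.exp (-s * L) :=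
          (h.hitProb_le_exp (c := ℓ z) (by simp) m x _).trans (Real.exp_le_exp.2 (by nlinarith))
        have h2 : √(hitProb κ {z} m x (merge W η ω)) ≤ Real.exp (-s * L / 2) := by
          rw [Real.exp_half]
          exact Real.sqrt_le_sqrt h1
        have h3 : (m : ℝ) ≤ n := by exact_mod_cast hm
        calc 2 * C * m * hitProb κ {z} m x (merge W η ω)
            = 2 * C * m * (√(hitProb κ {z} m x (merge W η ω)) *
              √(hitProb κ {z} m x (merge W η ω))) := by rw [Real.mul_self_sqrt hn]
          _ ≤ 2 * C * n * (Real.exp (-s * L / 2) * √(hitProb κ {z} m x (merge W η ω))) := by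
            gcongr
          _ = _ := by rw [hτ]; ring
      refine (abs_integral_le_integral_abs).trans ((integral_mono
        (((hb.merge W ω).sub (hb.merge W ω')).integrable _).abs
        ((hS.integrable _).const_mul τ) hle).trans ?_)
      rw [integral_const_mul]
      have := mul_nonneg hB0 (hA0 m x)
      exact le_add_of_nonneg_left this
  by_cases hx : x ∈ ({z} ∪ W : Set V)
  · exact hbd n le_rfl x hx
  refine abs_avg_sub_le_of_supersolution (κ := κ) (W := W) μ hβ hC hag
    (fun m x => B * avg μ W (hitProb κ {z} m x) ω +
      τ * avg μ W (fun ω => √(hitProb κ {z} m x ω)) ω) n (fun m x => ?_)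
    (fun x => ?_) (fun m hm => hbd m hm.le) (fun m x hx => ?_) n le_rfl x hx
  · exact ((((unifBdd_avg μ (hH m) W).bddMeas_site x ω).integrable _).const_mul B).add
      ((((unifBdd_avg μ (hH' m) W).bddMeas_site x ω).integrable _).const_mul τ)
  · exact add_nonneg (mul_nonneg hB0 (hA0 0 x)) (mul_nonneg hτ0 (hA0' 0 x))
  · have hxT : x ∉ ({z} : Set V) := fun hh => hx (Or.inl hh)
    have hxW : x ∉ W := fun hh => hx (Or.inr hh)
    rw [integral_add ((((unifBdd_avg μ (hH m) W).bddMeas_site x ω).integrable _).const_mul B)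
      ((((unifBdd_avg μ (hH' m) W).bddMeas_site x ω).integrable _).const_mul τ),
      integral_const_mul, integral_const_mul, ← avg_step μ (hH m) hxW, ← avg_step μ (hH' m) hxW]
    have e : (fun ω : V → S => ∫ y, hitProb κ {z} m (x + y) ω ∂κ (ω x)) =
        hitProb κ {z} (m + 1) x := by
      funext ω; rw [hitProb_of_notMem hxT]
    rw [e]
    have hm1 : BddMeas (fun ω : V → S => ∫ y, √(hitProb κ {z} m (x + y) ω) ∂κ (ω x)) :=
      ⟨measurable_step (hH' m) x, 1, fun ω => abs_integral_le_of_le fun y => by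
        rw [abs_of_nonneg (Real.sqrt_nonneg _), Real.sqrt_le_one]
        exact (le_abs_self _).trans (abs_hitProb_le _ _ _ _)⟩
    -- The `hitProb` term satisfies the recursion exactly; the square root is a supersolution by
    -- concavity.
    refine add_le_add le_rfl (mul_le_mul_of_nonneg_left ?_ hτ0)
    refine avg_mono μ hm1 ((hH' (m + 1)).bddMeas x) W ω fun ω => ?_
    rw [hitProb_of_notMem hxT]
    refine Real.le_sqrt_of_sq_le ((((hH' m).bddMeas_site x ω).integral_sq_le _).trans ?_)
    refine le_of_eq (integral_congr_ae (ae_of_all _ fun y => ?_))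
    exact Real.sq_sqrt (hitProb_nonneg _ _ _ _)

/-- Variance bound for additive functionals in terms of the intersections of two walks. -/
theorem variance_expSum_le (h : UpwardDrift κ ℓ s s' ρ) (hβ : Measurable β)
    (hC : ∀ p, |β p| ≤ C) {n L : ℕ} (hL : 1 ≤ L) {A₁ A₂ : ℝ}
    (h1 : ∀ t : Finset V, ∑ z ∈ t, ∫ ω, hitProb κ {z} n 0 ω
      ∂(Measure.infinitePi fun _ : V => μ) ≤ A₁)
    (h2 : ∀ t : Finset V, ∑ z ∈ t, ∫ ω, hitProb κ {z} n 0 ω ^ 2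
      ∂(Measure.infinitePi fun _ : V => μ) ≤ A₂) :
    ∫ ω, (expSum κ β n 0 ω - ∫ ω, expSum κ β n 0 ω ∂(Measure.infinitePi fun _ : V => μ)) ^ 2
      ∂(Measure.infinitePi fun _ : V => μ) ≤
      2 * (oscBound s s' ρ C n L + slabCost s' ρ C L) ^ 2 * A₂ +
        2 * (2 * C * n) ^ 2 * Real.exp (-s * L) * A₁ := by
  set B := oscBound s s' ρ C n L + slabCost s' ρ C L with hB
  have hg := (unifBdd_expSum (V := V) (κ := κ) hβ hC n).bddMeas 0
  refine integral_sq_sub_le μ ℓ hg (isLocal_expSum hC n 0) (fun z => upper ℓ (ℓ z + 1 + L))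
    (fun z j hj => ?_) fun t => ?_
  · have : ℓ z + 1 + L ≤ ℓ j := hj
    omega
  have hz : ∀ z : V, ∫ ω, avg μ (upper ℓ (ℓ z + 1 + L))
      (fun ω => expSum κ β n 0 ω - avg μ {z} (expSum κ β n 0) ω) ω ^ 2
      ∂(Measure.infinitePi fun _ : V => μ) ≤
      2 * B ^ 2 * ∫ ω, hitProb κ {z} n 0 ω ^ 2 ∂(Measure.infinitePi fun _ : V => μ) +
      2 * (2 * C * n) ^ 2 * Real.exp (-s * L) * ∫ ω, hitProb κ {z} n 0 ω
        ∂(Measure.infinitePi fun _ : V => μ) := by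
    intro z
    set W := upper ℓ (ℓ z + 1 + L) with hW
    have hH : BddMeas (hitProb (S := S) κ {z} n 0) := (unifBdd_hitProb _ n).bddMeas 0
    have hgW := hg.avg μ W
    have hpt : ∀ ω, avg μ W (fun ω => expSum κ β n 0 ω - avg μ {z} (expSum κ β n 0) ω) ω ^ 2 ≤
        2 * B ^ 2 * avg μ W (fun ω => hitProb κ {z} n 0 ω ^ 2) ω +
        2 * (2 * C * n) ^ 2 * Real.exp (-s * L) * avg μ W (hitProb κ {z} n 0) ω := by
      intro ω
      -- The averages over `{z}` and `W` commute, so the increment is a mean over `ζ` of differences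
      -- between environments that agree off `z`.
      have e : avg μ W (fun ω => expSum κ β n 0 ω - avg μ {z} (expSum κ β n 0) ω) ω =
          ∫ ζ, (avg μ W (expSum κ β n 0) ω - avg μ W (expSum κ β n 0) (merge {z} ζ ω))
            ∂(Measure.infinitePi fun _ : V => μ) := by
        rw [avg_sub μ hg (hg.avg μ {z}), avg_avg μ W {z} hg, Set.union_comm,
          ← avg_avg μ {z} W hg, integral_sub (integrable_const _)
            ((hgW.merge {z} ω).integrable _)]
        simp [avg.eq_1 μ {z}]
      have hle := abs_integral_le_of_le (P := Measure.infinitePi fun _ : V => μ)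
        fun ζ => abs_avg_sub_le_site (n := n) μ h hβ hC hL z 0 (ω := ω) (ω' := merge {z} ζ ω)
          fun x hx => (merge_of_notMem hx ζ ω).symm
      rw [← e] at hle
      rw [← sq_abs]
      -- After `(x + y)² ≤ 2 (x² + y²)`, Jensen within each `W`-average leaves `hitProb ^ 2` in one
      -- term and `hitProb` in the other.
      refine (pow_le_pow_left₀ (abs_nonneg _) hle 2).trans ((add_sq_le).trans ?_)
      have s1 := sq_avg_le μ W hH ω
      have s2 := sq_avg_le μ W hH.sqrt ω
      have e2 : avg μ W (fun ω => √(hitProb κ {z} n 0 ω) ^ 2) ω =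
          avg μ W (hitProb κ {z} n 0) ω := by
        congr 1
        funext ω
        exact Real.sq_sqrt (hitProb_nonneg _ _ _ _)
      rw [e2] at s2
      have e3 : Real.exp (-s * L / 2) ^ 2 = Real.exp (-s * L) := by
        rw [← Real.exp_nat_mul]; congr 1; push_cast; ring
      rw [mul_pow, mul_pow _ (avg _ _ _ _) 2, mul_pow _ (Real.exp _), e3]
      have t1 := mul_le_mul_of_nonneg_left s1 (by positivity : 0 ≤ 2 * B ^ 2)
      have t2 := mul_le_mul_of_nonneg_left s2
        (by positivity : 0 ≤ 2 * (2 * C * n) ^ 2 * Real.exp (-s * L))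
      linarith
    have hD := hg.sub (hg.avg μ {z})
    have i1 := ((hH.pow.avg μ W).integrable (Measure.infinitePi fun _ : V => μ)).const_mul
      (2 * B ^ 2)
    have i2 := ((hH.avg μ W).integrable (Measure.infinitePi fun _ : V => μ)).const_mul
      (2 * (2 * C * n) ^ 2 * Real.exp (-s * L))
    refine (integral_mono ((hD.avg μ W).pow.integrable _) (i1.add i2) hpt).trans (le_of_eq ?_)
    rw [integral_add' i1 i2, integral_const_mul, integral_const_mul, integral_avg μ W hH.pow,
      integral_avg μ W hH]
  refine (Finset.sum_le_sum fun z _ => hz z).trans ?_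
  rw [Finset.sum_add_distrib, ← Finset.mul_sum, ← Finset.mul_sum]
  exact add_le_add (mul_le_mul_of_nonneg_left (h2 t) (by positivity))
    (mul_le_mul_of_nonneg_left (h1 t) (by positivity))

end Oscillation

/-! ### The recursions as expectations under the quenched path measure. -/

section Walk

variable {d : ℕ}

/-- The Markov property at time `k`. `F` keeps the whole history because the indicator of a past
visit depends on it. -/
lemma integral_quenchedLaw_succ (z : Lattice d) (ω : Env d) (k : ℕ)
    {F : (Finset.Iic k → Lattice d) × Lattice d → ℝ}
    (hF : Integrable (fun X : Path d => F (Preorder.frestrictLe k X, X (k + 1)))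
      (quenchedLaw z ω)) :
    ∫ X, F (Preorder.frestrictLe k X, X (k + 1)) ∂(quenchedLaw z ω) =
      ∫ X, ∫ y, F (Preorder.frestrictLe k X, X k + y) ∂(ω (X k)).toMeasure ∂(quenchedLaw z ω) := by
  have hm : Measurable (fun X : Path d => (Preorder.frestrictLe (π := fun _ => Lattice d) k X,
      X (k + 1))) := by fun_prop
  have hFm : Measurable F := Measurable.of_discrete
  have h := Kernel.partialTraj_compProd_eq_map_traj (X := fun _ => Lattice d) (κ := histKernel ω) (Nat.zero_le k)
    (x₀ := fun _ => z)
  have hmap := Kernel.traj_map_frestrictLe_apply (X := fun _ => Lattice d) (κ := histKernel ω) 0 k (fun _ => z)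
  have hF' : Integrable F ((quenchedLaw z ω).map (fun X : Path d =>
      (Preorder.frestrictLe (π := fun _ => Lattice d) k X, X (k + 1)))) :=
    (integrable_map_measure hFm.aestronglyMeasurable hm.aemeasurable).2 hF
  rw [← integral_map (φ := fun X : Path d => (Preorder.frestrictLe (π := fun _ => Lattice d) k X,
      X (k + 1))) (f := F) hm.aemeasurable hFm.aestronglyMeasurable]
  unfold quenchedLaw at hF' ⊢
  rw [← h] at hF' ⊢
  rw [Measure.integral_compProd hF', ← hmap, integral_map (by fun_prop)
    Measurable.of_discrete.aestronglyMeasurable]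
  refine integral_congr_ae (ae_of_all _ fun X => ?_)
  change ∫ y, F (Preorder.frestrictLe k X, y) ∂((ω (X k)).map (fun z => X k + z)).toMeasure = _
  rw [← PMF.toMeasure_map _ _ Measurable.of_discrete, integral_map (by fun_prop)
    Measurable.of_discrete.aestronglyMeasurable]

lemma lintegral_quenchedLaw_succ (z : Lattice d) (ω : Env d) (k : ℕ)
    (F : Lattice d → ℝ≥0∞) :
    ∫⁻ X, F (X (k + 1)) ∂(quenchedLaw z ω) =
      ∫⁻ X, ∫⁻ y, F (X k + y) ∂(ω (X k)).toMeasure ∂(quenchedLaw z ω) := by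
  have hm : Measurable (fun X : Path d => (Preorder.frestrictLe (π := fun _ => Lattice d) k X,
      X (k + 1))) := by fun_prop
  have h := Kernel.partialTraj_compProd_eq_map_traj (X := fun _ => Lattice d) (κ := histKernel ω) (Nat.zero_le k)
    (x₀ := fun _ => z)
  have hmap := Kernel.traj_map_frestrictLe_apply (X := fun _ => Lattice d) (κ := histKernel ω) 0 k (fun _ => z)
  have hFm : Measurable (fun p : (Finset.Iic k → Lattice d) × Lattice d => F p.2) :=
    Measurable.of_discrete
  rw [← lintegral_map (f := fun p : (Finset.Iic k → Lattice d) × Lattice d => F p.2) hFm hm]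
  unfold quenchedLaw
  rw [← h, Measure.lintegral_compProd hFm, ← hmap, lintegral_map Measurable.of_discrete
    (by fun_prop)]
  refine lintegral_congr fun X => ?_
  change ∫⁻ y, F y ∂((ω (X k)).map (fun z => X k + z)).toMeasure = _
  rw [← PMF.toMeasure_map _ _ Measurable.of_discrete, lintegral_map Measurable.of_discrete
    Measurable.of_discrete]

lemma quenchedLaw_start (z : Lattice d) (ω : Env d) : ∀ᵐ X ∂(quenchedLaw z ω), X 0 = z := by
  have hmap := Kernel.traj_map_frestrictLe_apply (X := fun _ => Lattice d) (κ := histKernel ω) 0 0 (fun _ => z)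
  rw [Kernel.partialTraj_self, Kernel.id_apply] at hmap
  have h : ∀ᵐ x ∂((quenchedLaw z ω).map (Preorder.frestrictLe (π := fun _ => Lattice d) 0)),
      x ⟨0, Finset.mem_Iic.2 le_rfl⟩ = z := by
    unfold quenchedLaw
    rw [hmap, ae_dirac_eq]
    exact rfl
  exact ae_of_ae_map (by fun_prop) h

lemma measurable_toEuclid_coord (n : ℕ) : Measurable (fun X : Path d => toEuclid (X n)) :=
  (Measurable.of_discrete (f := toEuclid (d := d))).comp (measurable_pi_apply n)

lemma toEuclid_add (x y : Lattice d) : toEuclid (x + y) = toEuclid x + toEuclid y := by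
  ext i; simp [toEuclid]

lemma toEuclid_zero : toEuclid (0 : Lattice d) = 0 := by
  ext i; simp [toEuclid]

lemma lintegral_enorm_quenchedLaw_le {ω : Env d} {D : ℝ≥0∞}
    (hω : ∀ x, ∫⁻ y, ‖toEuclid y‖ₑ ∂(ω x).toMeasure ≤ D) (n : ℕ) :
    ∫⁻ X, ‖toEuclid (X n)‖ₑ ∂(quenchedLaw 0 ω) ≤ n * D := by
  induction n with
  | zero =>
    have : ∫⁻ X, ‖toEuclid (X 0)‖ₑ ∂(quenchedLaw 0 ω) = ∫⁻ _X, 0 ∂(quenchedLaw 0 ω) := by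
      refine lintegral_congr_ae ?_
      filter_upwards [quenchedLaw_start 0 ω] with X hX
      rw [hX, toEuclid_zero, enorm_zero]
    simp [this]
  | succ n ih =>
    rw [lintegral_quenchedLaw_succ 0 ω n (fun x => ‖toEuclid x‖ₑ)]
    have h : ∀ X : Path d, ∫⁻ y, ‖toEuclid (X n + y)‖ₑ ∂(ω (X n)).toMeasure ≤
        ‖toEuclid (X n)‖ₑ + D := by
      intro X
      calc ∫⁻ y, ‖toEuclid (X n + y)‖ₑ ∂(ω (X n)).toMeasure
          ≤ ∫⁻ y, (‖toEuclid (X n)‖ₑ + ‖toEuclid y‖ₑ) ∂(ω (X n)).toMeasure :=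
            lintegral_mono fun y => by rw [toEuclid_add]; exact enorm_add_le _ _
        _ = ‖toEuclid (X n)‖ₑ + ∫⁻ y, ‖toEuclid y‖ₑ ∂(ω (X n)).toMeasure := by
            rw [lintegral_add_left measurable_const]; simp
        _ ≤ _ := by gcongr; exact hω _
    refine (lintegral_mono h).trans ?_
    rw [lintegral_add_right _ measurable_const]
    simp only [lintegral_const, measure_univ, mul_one]
    push_cast
    rw [add_mul, one_mul]
    gcongr

lemma integrable_toEuclid_quenchedLaw {ω : Env d} {D : ℝ≥0∞} (hD : D ≠ ∞)
    (hω : ∀ x, ∫⁻ y, ‖toEuclid y‖ₑ ∂(ω x).toMeasure ≤ D) (n : ℕ) :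
    Integrable (fun X : Path d => toEuclid (X n)) (quenchedLaw 0 ω) :=
  ⟨(measurable_toEuclid_coord n).aestronglyMeasurable,
    (lintegral_enorm_quenchedLaw_le hω n).trans_lt
      (ENNReal.mul_lt_top (ENNReal.natCast_lt_top n) hD.lt_top)⟩

lemma abs_coord_le_norm (y : Lattice d) (i : Fin d) : |(y i : ℝ)| ≤ ‖toEuclid y‖ := by
  simpa [toEuclid] using EuclideanSpace.norm_eq (toEuclid y) ▸ PiLp.norm_apply_le (toEuclid y) i

lemma integrable_coord {P : Measure (Lattice d)} {D : ℝ≥0∞} (hD : D ≠ ∞)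
    (hP : ∫⁻ y, ‖toEuclid y‖ₑ ∂P ≤ D) (i : Fin d) : Integrable (fun y => (y i : ℝ)) P := by
  have h : Integrable (fun y : Lattice d => toEuclid y) P :=
    ⟨Measurable.of_discrete.aestronglyMeasurable, hP.trans_lt hD.lt_top⟩
  exact h.norm.mono' Measurable.of_discrete.aestronglyMeasurable
    (ae_of_all _ fun y => abs_coord_le_norm y i)

variable {κ : Kernel (Simplex d) (Lattice d)} [IsMarkovKernel κ]

/-- The quenched mean is an additive functional of the local drift. -/
lemma quenchedMean_apply {ω : Env d} (hκ : ∀ x, κ (ω x) = (ω x).toMeasure) {D : ℝ≥0∞}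
    (hD : D ≠ ∞) (hω : ∀ x, ∫⁻ y, ‖toEuclid y‖ₑ ∂(ω x).toMeasure ≤ D) {i : Fin d}
    {β : Simplex d → ℝ} (hβω : ∀ x, β (ω x) = ∫ y, (y i : ℝ) ∂(ω x).toMeasure)
    (hβ : Measurable β) {C : ℝ} (hC : ∀ p, |β p| ≤ C) (n : ℕ) :
    quenchedMean n ω i = expSum κ β n 0 ω := by
  have hint : ∀ k, Integrable (fun X : Path d => (X k i : ℝ)) (quenchedLaw 0 ω) := fun k =>
    (integrable_toEuclid_quenchedLaw hD hω k).norm.mono'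
      (Measurable.of_discrete (f := fun y : Lattice d => (y i : ℝ))
        |>.comp (measurable_pi_apply k)).aestronglyMeasurable
      (ae_of_all _ fun X => abs_coord_le_norm (X k) i)
  have hE : ∀ m k, Integrable (fun X : Path d => expSum κ β m (X k) ω) (quenchedLaw 0 ω) :=
    fun m k => Integrable.of_bound (Measurable.of_discrete (f := fun y => expSum κ β m y ω)
        |>.comp (measurable_pi_apply k)).aestronglyMeasurable (C * m)
      (ae_of_all _ fun X => abs_expSum_le hC m (X k) ω)
  -- Present position plus the expected drift of the remaining steps has constant mean; `k = 0` and
  -- `k = n` give the two sides.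
  have hconst : ∀ k ≤ n, ∫ X, ((X k i : ℝ) + expSum κ β (n - k) (X k) ω) ∂(quenchedLaw 0 ω) =
      expSum κ β n 0 ω := by
    intro k
    induction k with
    | zero =>
      intro _
      have : ∀ᵐ X ∂(quenchedLaw 0 ω), ((X 0 i : ℝ) + expSum κ β (n - 0) (X 0) ω) =
          expSum κ β n 0 ω := by
        filter_upwards [quenchedLaw_start 0 ω] with X hX
        simp [hX]
      rw [integral_congr_ae this]
      simp
    | succ k ih =>
      intro hk
      rw [← ih (by omega)]
      refine (integral_quenchedLaw_succ 0 ω k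
        (F := fun p => (p.2 i : ℝ) + expSum κ β (n - (k + 1)) p.2 ω)
        ((hint (k + 1)).add (hE _ _))).trans ?_
      refine integral_congr_ae (ae_of_all _ fun X => ?_)
      have e : n - k = n - (k + 1) + 1 := by omega
      have hi := integrable_coord hD (hω (X k)) i
      have hs := ((unifBdd_expSum (V := Lattice d) (κ := κ) hβ hC
        (n - (k + 1))).bddMeas_site (X k) ω).integrable (ω (X k)).toMeasure
      simp only [e, expSum, hκ, hβω, Pi.add_apply, Int.cast_add]
      have hi' : Integrable (fun y : Lattice d => (X k i : ℝ) + (y i : ℝ)) (ω (X k)).toMeasure :=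
        (integrable_const _).add hi
      rw [integral_add hi' hs, integral_add (integrable_const _) hi]
      simp [add_assoc]
  have hn := hconst n le_rfl
  simp only [Nat.sub_self, expSum, add_zero] at hn
  rw [← hn, quenchedMean]
  change (∫ X, toEuclid (X n) ∂(quenchedLaw 0 ω)).ofLp i = _
  have := (EuclideanSpace.proj i : EuclideanSpace ℝ (Fin d) →L[ℝ] ℝ).integral_comp_comm
    (integrable_toEuclid_quenchedLaw hD hω n)
  simpa [toEuclid] using this.symm

lemma mem_sites {X : Path d} {n : ℕ} {z : Lattice d} : z ∈ sites X n ↔ ∃ k < n, X k = z := by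
  simp [sites]

lemma measurable_sites_indicator (n : ℕ) (z : Lattice d) :
    Measurable (fun X : Path d => if z ∈ sites X n then (1 : ℝ) else 0) := by
  refine Measurable.ite ?_ measurable_const measurable_const
  have : {X : Path d | z ∈ sites X n} = ⋃ k ∈ Finset.range n, (fun X => X k) ⁻¹' {z} := by
    ext X; simp [mem_sites]
  rw [this]
  exact Finset.measurableSet_biUnion _ fun k _ => measurable_pi_apply k (measurableSet_singleton z)

lemma bddMeas_sites (n : ℕ) (z : Lattice d) :
    BddMeas (fun X : Path d => if z ∈ sites X n then (1 : ℝ) else 0) :=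
  ⟨measurable_sites_indicator n z, 1, fun X => by dsimp only; split_ifs <;> simp⟩

/-- The recursion `hitProb` computes the probability of a visit to `z` before time `n`. -/
lemma integral_sites_eq_hitProb {ω : Env d} (hκ : ∀ x, κ (ω x) = (ω x).toMeasure) (n : ℕ)
    (z : Lattice d) :
    ∫ X, (if z ∈ sites X n then (1 : ℝ) else 0) ∂(quenchedLaw 0 ω) = hitProb κ {z} n 0 ω := by
  have hH : ∀ m k, BddMeas (fun X : Path d => hitProb κ {z} m (X k) ω) := fun m k =>
    ⟨(Measurable.of_discrete (f := fun y => hitProb κ {z} m y ω)).comp (measurable_pi_apply k),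
      1, fun X => abs_hitProb_le _ _ _ _⟩
  -- The conditional probability of a visit before time `n`, given the past, is a martingale: it is
  -- 1 once `z` has been visited and `hitProb` at the current site otherwise.
  have hconst : ∀ k ≤ n, ∫ X, ((if z ∈ sites X k then (1 : ℝ) else 0) +
      (1 - if z ∈ sites X k then (1 : ℝ) else 0) * hitProb κ {z} (n - k) (X k) ω)
        ∂(quenchedLaw 0 ω) = hitProb κ {z} n 0 ω := by
    intro k
    induction k with
    | zero =>
      intro _
      have : ∀ᵐ X ∂(quenchedLaw 0 ω), ((if z ∈ sites X 0 then (1 : ℝ) else 0) +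
          (1 - if z ∈ sites X 0 then (1 : ℝ) else 0) * hitProb κ {z} (n - 0) (X 0) ω) =
          hitProb κ {z} n 0 ω := by
        filter_upwards [quenchedLaw_start 0 ω] with X hX
        simp [hX, sites]
      rw [integral_congr_ae this]
      simp
    | succ k ih =>
      intro hk
      rw [← ih (by omega)]
      classical
      set a : (Finset.Iic k → Lattice d) → ℝ := fun h => if ∃ j, h j = z then 1 else 0 with ha
      have hak : ∀ X : Path d, (if z ∈ sites X (k + 1) then (1 : ℝ) else 0) =
          a (Preorder.frestrictLe k X) := by
        intro X
        simp only [ha, mem_sites, Subtype.exists, Finset.mem_Iic, Preorder.frestrictLe_apply,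
          Nat.lt_succ_iff, exists_prop]
      have hI : BddMeas (fun X : Path d => (if z ∈ sites X (k + 1) then (1 : ℝ) else 0) +
          (1 - if z ∈ sites X (k + 1) then (1 : ℝ) else 0) *
            hitProb κ {z} (n - (k + 1)) (X (k + 1)) ω) :=
        (bddMeas_sites (k + 1) z).add
          (((BddMeas.const 1).sub (bddMeas_sites (k + 1) z)).mul (hH _ _))
      have hI' := hI.integrable (quenchedLaw 0 ω)
      simp only [hak] at hI' ⊢
      rw [integral_quenchedLaw_succ 0 ω k
        (F := fun p => a p.1 + (1 - a p.1) * hitProb κ {z} (n - (k + 1)) p.2 ω) hI']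
      refine integral_congr_ae (ae_of_all _ fun X => ?_)
      have hs := ((unifBdd_hitProb (S := Simplex d) (κ := κ) {z}
        (n - (k + 1))).bddMeas_site (X k) ω).integrable (ω (X k)).toMeasure
      have e : n - k = n - (k + 1) + 1 := by omega
      simp only [← hak]
      rw [integral_add (integrable_const _) (hs.const_mul _), integral_const_mul, e]
      simp only [integral_const, probReal_univ, smul_eq_mul, one_mul]
      by_cases hz : X k = z
      · have hm : z ∈ sites X (k + 1) := mem_sites.2 ⟨k, Nat.lt_succ_self k, hz⟩
        rw [if_pos hm, hitProb_of_mem (show X k ∈ ({z} : Set (Lattice d)) from hz)]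
        ring
      · have hm : z ∈ sites X (k + 1) ↔ z ∈ sites X k := by
          simp only [mem_sites]
          constructor
          · rintro ⟨j, hj, rfl⟩
            refine ⟨j, lt_of_le_of_ne (Nat.lt_succ_iff.1 hj) ?_, rfl⟩
            rintro rfl
            exact hz rfl
          · rintro ⟨j, hj, rfl⟩
            exact ⟨j, hj.trans (Nat.lt_succ_self k), rfl⟩
        rw [hitProb_of_notMem (show X k ∉ ({z} : Set (Lattice d)) from hz), hκ]
        simp only [hm]
  have hn := hconst n le_rfl
  simpa [hitProb] using hn

end Walk

/-! ### Uniform exponential drift bounds from the moment assumptions. -/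

section GoodSites

variable {d : ℕ}

lemma exp_le_quadratic (t : ℝ) : Real.exp t ≤ 1 + t + t ^ 2 * Real.exp |t| := by
  have h := Complex.norm_exp_sub_sum_le_norm_mul_exp (t : ℂ) 2
  simp only [Finset.sum_range_succ, Finset.sum_range_zero, pow_zero, Nat.factorial_zero,
    Nat.cast_one, div_one, zero_add, pow_one, Nat.factorial_one, Complex.norm_real,
    Real.norm_eq_abs, sq_abs] at h
  rw [← Complex.ofReal_exp, ← Complex.ofReal_one, ← Complex.ofReal_add, ← Complex.ofReal_sub,
    Complex.norm_real, Real.norm_eq_abs] at h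
  linarith [(abs_le.1 h).2]

lemma abs_dotProduct_le (z u : Lattice d) :
    |((z ⬝ᵥ u : ℤ) : ℝ)| ≤ ‖toEuclid u‖ * ‖toEuclid z‖ := by
  have h := abs_real_inner_le_norm (toEuclid u) (toEuclid z)
  have e : inner ℝ (toEuclid u) (toEuclid z) = ((z ⬝ᵥ u : ℤ) : ℝ) := by
    simp [toEuclid, dotProduct, PiLp.inner_apply]
  rwa [e] at h

/-- The quadratic remainder fits into the exponential moment: half of `s₀ * r` dominates `|s * j|`,
and the other half absorbs `r ^ 2` through `x ^ 2 / 2 ≤ exp x` at `x = s₀ * r / 2`. -/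
lemma exp_level_le {s₀ s U r j : ℝ} (hs₀ : 0 < s₀) (hs : 0 ≤ s)
    (hsU : s * U ≤ s₀ / 2) (hr : 0 ≤ r) (hj : |j| ≤ U * r) :
    Real.exp (-s * j) ≤ 1 - s * j + s ^ 2 * (8 * U ^ 2 / s₀ ^ 2) * Real.exp (s₀ * r) := by
  have h1 := exp_le_quadratic (-s * j)
  have h2 : |-s * j| ≤ s₀ * r / 2 := by
    rw [abs_mul, abs_neg, abs_of_nonneg hs]
    nlinarith [mul_le_mul_of_nonneg_left hj hs, mul_le_mul_of_nonneg_right hsU hr]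
  have h3 : j ^ 2 ≤ U ^ 2 * r ^ 2 := by
    rw [← sq_abs, ← mul_pow]
    exact pow_le_pow_left₀ (abs_nonneg _) hj 2
  have h4 : r ^ 2 ≤ 8 / s₀ ^ 2 * Real.exp (s₀ * r / 2) := by
    have hx := Real.quadratic_le_exp_of_nonneg (by positivity : 0 ≤ s₀ * r / 2)
    rw [div_mul_eq_mul_div, le_div_iff₀ (by positivity)]
    nlinarith [mul_nonneg hs₀.le hr]
  have h5 : Real.exp |-s * j| ≤ Real.exp (s₀ * r / 2) := Real.exp_le_exp.2 h2
  have h6 : Real.exp (s₀ * r) = Real.exp (s₀ * r / 2) * Real.exp (s₀ * r / 2) := by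
    rw [← Real.exp_add]; congr 1; ring
  have h7 : (-s * j) ^ 2 * Real.exp |-s * j| ≤
      s ^ 2 * (8 * U ^ 2 / s₀ ^ 2) * Real.exp (s₀ * r) := by
    calc (-s * j) ^ 2 * Real.exp |-s * j|
        ≤ (s ^ 2 * (U ^ 2 * (8 / s₀ ^ 2 * Real.exp (s₀ * r / 2)))) * Real.exp (s₀ * r / 2) := by
          refine mul_le_mul ?_ h5 (Real.exp_pos _).le (by positivity)
          have : (-s * j) ^ 2 = s ^ 2 * j ^ 2 := by ring
          rw [this]
          refine mul_le_mul_of_nonneg_left (h3.trans ?_) (sq_nonneg s)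
          exact mul_le_mul_of_nonneg_left h4 (sq_nonneg U)
      _ = _ := by rw [h6]; ring
  linarith

lemma lintegral_ofReal_pmf (p : PMF (Lattice d)) {g : Lattice d → ℝ} (hg : ∀ z, 0 ≤ g z)
    (hs : Summable fun z => g z * (p z).toReal) :
    ∫⁻ z, ENNReal.ofReal (g z) ∂p.toMeasure = ENNReal.ofReal (∑' z, g z * (p z).toReal) := by
  rw [lintegral_countable',
    ENNReal.ofReal_tsum_of_nonneg (fun z => mul_nonneg (hg z) ENNReal.toReal_nonneg) hs]
  refine tsum_congr fun z => ?_
  rw [PMF.toMeasure_apply_singleton _ _ (measurableSet_singleton z), ENNReal.ofReal_mul (hg z),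
    ENNReal.ofReal_toReal (p.apply_ne_top z)]

lemma integrable_of_lintegral_ofReal_le {P : Measure (Lattice d)} {g : Lattice d → ℝ}
    (hg : ∀ z, 0 ≤ g z) {E : ℝ} (h : ∫⁻ z, ENNReal.ofReal (g z) ∂P ≤ ENNReal.ofReal E) :
    Integrable g P := by
  refine ⟨Measurable.of_discrete.aestronglyMeasurable, ?_⟩
  rw [hasFiniteIntegral_iff_ofReal (ae_of_all _ hg)]
  exact h.trans_lt ENNReal.ofReal_lt_top

lemma integral_le_of_lintegral_ofReal_le {P : Measure (Lattice d)} {g : Lattice d → ℝ}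
    (hg : ∀ z, 0 ≤ g z) {E : ℝ} (hE : 0 ≤ E)
    (h : ∫⁻ z, ENNReal.ofReal (g z) ∂P ≤ ENNReal.ofReal E) : ∫ z, g z ∂P ≤ E := by
  rw [integral_eq_lintegral_of_nonneg_ae (ae_of_all _ hg)
    Measurable.of_discrete.aestronglyMeasurable]
  exact ENNReal.toReal_le_of_le_ofReal hE h

/-- The conditions on a jump law used in the variance estimate. -/
def GoodSite (u : Lattice d) (s s' ρ C : ℝ) (p : Simplex d) : Prop :=
  ∫⁻ y, ENNReal.ofReal (Real.exp (-s * ((y ⬝ᵥ u : ℤ) : ℝ))) ∂p.toMeasure ≤ ENNReal.ofReal 1 ∧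
  ∫⁻ y, ENNReal.ofReal (Real.exp (-s' * ((y ⬝ᵥ u : ℤ) : ℝ))) ∂p.toMeasure ≤ ENNReal.ofReal ρ ∧
  ∫⁻ y, ‖toEuclid y‖ₑ ∂p.toMeasure ≤ ENNReal.ofReal C

/-- The jump law at a site as a kernel. -/
noncomputable def siteKernel (d : ℕ) : Kernel (Simplex d) (Lattice d) where
  toFun p := p.toMeasure
  measurable' := by
    refine Measure.measurable_of_measurable_coe _ fun t ht => ?_
    simp only [PMF.toMeasure_apply_eq_tsum]
    refine Measurable.tsum fun z => ?_
    by_cases hz : z ∈ t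
    · simp only [Set.indicator_of_mem hz]
      exact (measurable_pi_apply z).comp
        (comap_measurable (fun (p : Simplex d) (z : Lattice d) => p z))
    · simp only [Set.indicator_of_notMem hz]
      exact measurable_const

instance : IsMarkovKernel (siteKernel d) :=
  ⟨fun p => inferInstanceAs (IsProbabilityMeasure p.toMeasure)⟩

lemma measurableSet_goodSite (u : Lattice d) (s s' ρ C : ℝ) :
    MeasurableSet {p | GoodSite u s s' ρ C p} := by
  have h : ∀ f : Lattice d → ℝ≥0∞, Measurable fun p : Simplex d => ∫⁻ y, f y ∂p.toMeasure :=
    fun f => Measurable.lintegral_kernel (κ := siteKernel d) Measurable.of_discrete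
  exact (measurableSet_le (h _) measurable_const).inter
    ((measurableSet_le (h _) measurable_const).inter (measurableSet_le (h _) measurable_const))

/-- Second-order expansion bounds the mean of the exponential by `1 - t * δ` plus a remainder at
most `t * δ / 2`, for every `t ≤ s`; this serves both exponents. The first moment uses `r ≤ exp (s₀
* r) / s₀`. -/
lemma goodSite_of_moments {p : Simplex d} {u : Lattice d} {δ s₀ E : ℝ} (hs₀ : 0 < s₀)
    (hN : δ ≤ ∑' z : Lattice d, ((z ⬝ᵥ u : ℤ) : ℝ) * (p z).toReal)
    (hM : Summable fun z : Lattice d => Real.exp (s₀ * ‖toEuclid z‖) * (p z).toReal)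
    (hM' : ∑' z : Lattice d, Real.exp (s₀ * ‖toEuclid z‖) * (p z).toReal ≤ E)
    {U : ℝ} (hU : ‖toEuclid u‖ ≤ U) {s s' : ℝ} (hs' : 0 ≤ s') (hss : s' ≤ s)
    (hsU : s * U ≤ s₀ / 2) (hsδ : s * (8 * U ^ 2 / s₀ ^ 2) * E ≤ δ / 2) (hδ : 0 ≤ δ) :
    GoodSite u s s' (1 - s' * δ / 2) (E / s₀) p := by
  have hU0 : 0 ≤ U := (norm_nonneg _).trans hU
  have hl := lintegral_ofReal_pmf p (fun z => (Real.exp_pos (s₀ * ‖toEuclid z‖)).le) hM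
  have hl' := hl.le.trans (ENNReal.ofReal_le_ofReal hM')
  have hE0 : 0 ≤ E := le_trans
    (tsum_nonneg fun z => mul_nonneg (Real.exp_pos _).le ENNReal.toReal_nonneg) hM'
  have hint := integrable_of_lintegral_ofReal_le (fun z => (Real.exp_pos _).le) hl'
  have hintE := integral_le_of_lintegral_ofReal_le (fun z => (Real.exp_pos _).le) hE0 hl'
  have hr : ∀ z : Lattice d, ‖toEuclid z‖ ≤ Real.exp (s₀ * ‖toEuclid z‖) / s₀ := by
    intro z
    rw [le_div_iff₀ hs₀]
    linarith [Real.add_one_le_exp (s₀ * ‖toEuclid z‖)]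
  have hj : ∀ z : Lattice d, |((z ⬝ᵥ u : ℤ) : ℝ)| ≤ U * ‖toEuclid z‖ := fun z =>
    (abs_dotProduct_le z u).trans (mul_le_mul_of_nonneg_right hU (norm_nonneg _))
  have hjint : Integrable (fun z : Lattice d => ((z ⬝ᵥ u : ℤ) : ℝ)) p.toMeasure :=
    ((hint.div_const s₀).const_mul U).mono' Measurable.of_discrete.aestronglyMeasurable
      (ae_of_all _ fun z => (hj z).trans (mul_le_mul_of_nonneg_left (hr z) hU0))
  have hdrift : δ ≤ ∫ z, ((z ⬝ᵥ u : ℤ) : ℝ) ∂p.toMeasure := by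
    rw [PMF.integral_eq_tsum _ _ hjint]
    simpa only [smul_eq_mul, mul_comm] using hN
  have hexp : ∀ t, 0 ≤ t → t ≤ s →
      ∫⁻ y, ENNReal.ofReal (Real.exp (-t * ((y ⬝ᵥ u : ℤ) : ℝ))) ∂p.toMeasure ≤
        ENNReal.ofReal (1 - t * δ / 2) := by
    intro t ht hts
    have hpt : ∀ z : Lattice d, Real.exp (-t * ((z ⬝ᵥ u : ℤ) : ℝ)) ≤ 1 - t * ((z ⬝ᵥ u : ℤ) : ℝ) +
        t ^ 2 * (8 * U ^ 2 / s₀ ^ 2) * Real.exp (s₀ * ‖toEuclid z‖) := fun z =>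
      exp_level_le hs₀ ht ((mul_le_mul_of_nonneg_right hts hU0).trans hsU) (norm_nonneg _) (hj z)
    have i1 : Integrable (fun z : Lattice d => 1 - t * ((z ⬝ᵥ u : ℤ) : ℝ)) p.toMeasure :=
      (integrable_const _).sub (hjint.const_mul t)
    have i2 := hint.const_mul (t ^ 2 * (8 * U ^ 2 / s₀ ^ 2))
    have i3 : Integrable (fun z : Lattice d => Real.exp (-t * ((z ⬝ᵥ u : ℤ) : ℝ))) p.toMeasure :=
      (i1.add i2).mono' Measurable.of_discrete.aestronglyMeasurable
        (ae_of_all _ fun z => by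
          rw [Real.norm_eq_abs, abs_of_pos (Real.exp_pos _)]; exact hpt z)
    rw [← ofReal_integral_eq_lintegral_ofReal i3 (ae_of_all _ fun z => (Real.exp_pos _).le)]
    refine ENNReal.ofReal_le_ofReal ((integral_mono i3 (i1.add i2) hpt).trans ?_)
    rw [integral_add' i1 i2, integral_sub (integrable_const _) (hjint.const_mul t),
      integral_const_mul, integral_const_mul]
    simp only [integral_const, probReal_univ, smul_eq_mul, one_mul]
    have h1 := mul_le_mul_of_nonneg_left hdrift ht
    have h2 : t ^ 2 * (8 * U ^ 2 / s₀ ^ 2) *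
        ∫ z, Real.exp (s₀ * ‖toEuclid z‖) ∂p.toMeasure ≤ t * (δ / 2) := by
      have h3 : t * (8 * U ^ 2 / s₀ ^ 2) * E ≤ δ / 2 := by
        refine le_trans ?_ hsδ
        gcongr
      calc t ^ 2 * (8 * U ^ 2 / s₀ ^ 2) * ∫ z, Real.exp (s₀ * ‖toEuclid z‖) ∂p.toMeasure
          ≤ t ^ 2 * (8 * U ^ 2 / s₀ ^ 2) * E := by gcongr
        _ = t * (t * (8 * U ^ 2 / s₀ ^ 2) * E) := by ring
        _ ≤ _ := mul_le_mul_of_nonneg_left h3 ht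
    linarith
  refine ⟨(hexp s (hs'.trans hss) le_rfl).trans (ENNReal.ofReal_le_ofReal ?_), hexp s' hs' hss, ?_⟩
  · have := mul_nonneg (hs'.trans hss) hδ
    linarith
  · calc ∫⁻ y, ‖toEuclid y‖ₑ ∂p.toMeasure
        ≤ ∫⁻ y, ENNReal.ofReal (Real.exp (s₀ * ‖toEuclid y‖) / s₀) ∂p.toMeasure :=
          lintegral_mono fun y => by
            rw [← ofReal_norm]; exact ENNReal.ofReal_le_ofReal (hr y)
      _ ≤ _ := by
          rw [← ofReal_integral_eq_lintegral_ofReal (hint.div_const s₀)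
            (ae_of_all _ fun z => div_nonneg (Real.exp_pos _).le hs₀.le), integral_div]
          exact ENNReal.ofReal_le_ofReal (div_le_div_of_nonneg_right hintE hs₀.le)

open Classical in
/-- The jump law at a site, with bad sites replaced by a fixed good one. -/
noncomputable def goodKernel (u : Lattice d) (s s' ρ C : ℝ) (p₀ : Simplex d) :
    Kernel (Simplex d) (Lattice d) :=
  Kernel.piecewise (measurableSet_goodSite u s s' ρ C) (siteKernel d)
    (Kernel.const _ p₀.toMeasure)

instance (u : Lattice d) (s s' ρ C : ℝ) (p₀ : Simplex d) :
    IsMarkovKernel (goodKernel u s s' ρ C p₀) := by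
  unfold goodKernel; infer_instance

lemma goodKernel_of_good {u : Lattice d} {s s' ρ C : ℝ} {p : Simplex d} (p₀ : Simplex d)
    (hp : GoodSite u s s' ρ C p) : goodKernel u s s' ρ C p₀ p = p.toMeasure := by
  classical
  rw [goodKernel, Kernel.piecewise_apply]
  exact if_pos hp

lemma exists_goodKernel_eq {u : Lattice d} {s s' ρ C : ℝ} {p₀ : Simplex d}
    (hp₀ : GoodSite u s s' ρ C p₀) (p : Simplex d) :
    ∃ q, GoodSite u s s' ρ C q ∧ goodKernel u s s' ρ C p₀ p = q.toMeasure := by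
  by_cases hp : GoodSite u s s' ρ C p
  · exact ⟨p, hp, goodKernel_of_good p₀ hp⟩
  · refine ⟨p₀, hp₀, ?_⟩
    classical
    rw [goodKernel, Kernel.piecewise_apply]
    exact if_neg hp

/-- The level of a site in direction `u`. -/
def level (u : Lattice d) : Lattice d →+ ℤ :=
  AddMonoidHom.mk' (fun z => z ⬝ᵥ u) fun x y => add_dotProduct x y u

/-- Replacing bad sites makes the drift bounds hold for every jump law, as the suprema over
environments require, and almost surely changes nothing. -/
lemma upwardDrift_goodKernel {u : Lattice d} {s s' ρ C : ℝ} {p₀ : Simplex d}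
    (hp₀ : GoodSite u s s' ρ C p₀) (hs' : 0 < s') (hss : s' ≤ s) (hρ0 : 0 ≤ ρ) (hρ : ρ < 1) :
    UpwardDrift (goodKernel u s s' ρ C p₀) (level u) s s' ρ := by
  refine ⟨fun p => ?_, fun p => ?_, fun p => ?_, fun p => ?_, hs', hss, hρ⟩ <;>
    obtain ⟨q, hq, e⟩ := exists_goodKernel_eq hp₀ p <;> rw [e]
  · exact integrable_of_lintegral_ofReal_le (fun z => (Real.exp_pos _).le) hq.1
  · exact integral_le_of_lintegral_ofReal_le (fun z => (Real.exp_pos _).le) zero_le_one hq.1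
  · exact integrable_of_lintegral_ofReal_le (fun z => (Real.exp_pos _).le) hq.2.1
  · exact integral_le_of_lintegral_ofReal_le (fun z => (Real.exp_pos _).le) hρ0 hq.2.1

open Classical in
/-- A coordinate of the local drift, set to zero at bad sites. -/
noncomputable def localDrift (u : Lattice d) (s s' ρ C : ℝ) (i : Fin d) (p : Simplex d) : ℝ :=
  if GoodSite u s s' ρ C p then ∫ y, (y i : ℝ) ∂p.toMeasure else 0

lemma measurable_localDrift (u : Lattice d) (s s' ρ C : ℝ) (i : Fin d) :
    Measurable (localDrift u s s' ρ C i) := by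
  refine Measurable.ite (measurableSet_goodSite u s s' ρ C) ?_ measurable_const
  exact (StronglyMeasurable.integral_kernel (κ := siteKernel d)
    (f := fun y : Lattice d => (y i : ℝ)) Measurable.of_discrete.stronglyMeasurable).measurable

lemma abs_localDrift_le (u : Lattice d) (s s' ρ : ℝ) {C : ℝ} (hC : 0 ≤ C) (i : Fin d)
    (p : Simplex d) : |localDrift u s s' ρ C i p| ≤ C := by
  unfold localDrift
  split_ifs with hp
  · have h : ∫⁻ y, ENNReal.ofReal ‖toEuclid y‖ ∂p.toMeasure ≤ ENNReal.ofReal C := by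
      simpa only [ofReal_norm] using hp.2.2
    refine abs_integral_le_integral_abs.trans (le_trans ?_
      (integral_le_of_lintegral_ofReal_le (fun y => norm_nonneg _) hC h))
    exact integral_mono (integrable_coord ENNReal.ofReal_ne_top hp.2.2 i).abs
      (integrable_of_lintegral_ofReal_le (fun y => norm_nonneg _) h)
      fun y => abs_coord_le_norm y i
  · simpa using hC

/-- Almost every environment is good at every site. -/
lemma ae_goodSite (μ : Measure (Simplex d)) [IsProbabilityMeasure μ] {u : Lattice d}
    {s s' ρ C : ℝ} (h : ∀ᵐ ω ∂(iidEnv μ), GoodSite u s s' ρ C (ω 0)) :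
    (∃ p, GoodSite u s s' ρ C p) ∧ ∀ᵐ ω ∂(iidEnv μ), ∀ x, GoodSite u s s' ρ C (ω x) := by
  have hmap : ∀ x : Lattice d, (iidEnv μ).map (fun ω => ω x) = μ := fun x =>
    Measure.infinitePi_map_eval (fun _ : Lattice d => μ) x
  have hev : ∀ x : Lattice d, Measurable fun ω : Env d => ω x := fun x => measurable_pi_apply x
  have hμ : ∀ᵐ p ∂μ, GoodSite u s s' ρ C p := by
    rw [← hmap 0, ae_map_iff (hev 0).aemeasurable (measurableSet_goodSite u s s' ρ C)]
    exact h
  refine ⟨hμ.exists, ae_all_iff.2 fun x => ?_⟩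
  rw [← hmap x] at hμ
  exact ae_of_ae_map (hev x).aemeasurable hμ

/-- Non-nestling and exponential moments provide good sites for all small exponents. -/
lemma exists_goodSite {μ : Measure (Simplex d)} [IsProbabilityMeasure μ]
    (hN : NonNestling (iidEnv μ)) (hM : ExpMoment (iidEnv μ)) :
    ∃ (u : Lattice d) (s δ C : ℝ), 0 < s ∧ 0 < δ ∧ 0 ≤ C ∧ s * δ ≤ 2 ∧
      ∀ s', 0 ≤ s' → s' ≤ s →
        ∀ᵐ ω ∂(iidEnv μ), GoodSite u s s' (1 - s' * δ / 2) C (ω 0) := by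
  obtain ⟨u, δ, -, hδ, hN⟩ := hN
  obtain ⟨M, s₀, -, hs₀, hM⟩ := hM
  set U := ‖toEuclid u‖ + 1 with hU
  have hU0 : 0 < U := by positivity
  set E := Real.exp (s₀ * M) with hE
  have hE0 : 0 < E := Real.exp_pos _
  set Q := 8 * U ^ 2 / s₀ ^ 2 with hQ
  have hQ0 : 0 < Q := by positivity
  -- The three caps on `s` ensure `s * U ≤ s₀ / 2`, a remainder of at most half the drift, and `s *
  -- δ ≤ 2`, so that `1 - s' * δ / 2` is nonnegative. Only `s` is fixed here; `s'` stays free.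
  refine ⟨u, min (s₀ / 2 / U) (min (δ / 2 / (Q * E)) (2 / δ)), δ, E / s₀, by positivity, hδ,
    by positivity, ?_, fun s' hs' hss => ?_⟩
  · rw [← le_div_iff₀ hδ]
    exact (min_le_right _ _).trans (min_le_right _ _)
  · filter_upwards [hN, hM] with ω h1 h2
    simp only [transProb, sub_zero] at h1 h2
    refine goodSite_of_moments hs₀ h1.2 h2.1 h2.2 (U := U) (by linarith) hs' hss ?_ ?_ hδ.le
    · rw [← le_div_iff₀ hU0]
      exact min_le_left _ _
    · rw [mul_assoc, ← le_div_iff₀ (by positivity)]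
      exact (min_le_right _ _).trans (min_le_left _ _)

end GoodSites

/-! ### Hitting probabilities and common sites of two walks; averaged laws. -/

section Intersections

variable {d : ℕ} {κ : Kernel (Simplex d) (Lattice d)} [IsMarkovKernel κ]

lemma sum_hitProb_le {ω : Env d} (hκ : ∀ x, κ (ω x) = (ω x).toMeasure) (n : ℕ)
    (t : Finset (Lattice d)) : ∑ z ∈ t, hitProb κ {z} n 0 ω ≤ n := by
  simp only [← integral_sites_eq_hitProb hκ]
  rw [← integral_finsetSum _ fun z _ => (bddMeas_sites n z).integrable _]
  have hle : ∀ X : Path d, ∑ z ∈ t, (if z ∈ sites X n then (1 : ℝ) else 0) ≤ n := by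
    intro X
    rw [Finset.sum_boole]
    have h1 : (t.filter (· ∈ sites X n)).card ≤ (sites X n).card :=
      Finset.card_le_card fun z hz => (Finset.mem_filter.1 hz).2
    have h2 : (sites X n).card ≤ n := Finset.card_image_le.trans (Finset.card_range n).le
    exact_mod_cast h1.trans h2
  refine (integral_mono (integrable_finsetSum _ fun z _ => (bddMeas_sites n z).integrable _)
    (integrable_const (n : ℝ)) hle).trans ?_
  simp

lemma measurable_card_sites_inter (n : ℕ) :
    Measurable fun XY : Path d × Path d => ((sites XY.1 n ∩ sites XY.2 n).card : ℝ) := by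
  have h : Measurable fun XY : Path d × Path d => fun k : Fin n => (XY.1 k, XY.2 k) :=
    measurable_pi_iff.2 fun k => ((measurable_pi_apply _).comp measurable_fst).prodMk
      ((measurable_pi_apply _).comp measurable_snd)
  have e : (fun XY : Path d × Path d => ((sites XY.1 n ∩ sites XY.2 n).card : ℝ)) =
      (fun v : Fin n → Lattice d × Lattice d =>
        (((Finset.univ.image fun k => (v k).1) ∩ Finset.univ.image fun k => (v k).2).card : ℝ)) ∘
      fun XY : Path d × Path d => fun k : Fin n => (XY.1 k, XY.2 k) := by
    funext XY
    have hs : ∀ X : Path d, sites X n = Finset.univ.image fun k : Fin n => X k := by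
      intro X
      ext z
      simp only [mem_sites, Finset.mem_image, Finset.mem_univ, true_and]
      exact ⟨fun ⟨k, hk, h⟩ => ⟨⟨k, hk⟩, h⟩, fun ⟨k, h⟩ => ⟨k, k.2, h⟩⟩
    simp only [hs, Function.comp]
  rw [e]
  exact Measurable.of_discrete.comp h

lemma bddMeas_card_sites_inter (n : ℕ) :
    BddMeas fun XY : Path d × Path d => ((sites XY.1 n ∩ sites XY.2 n).card : ℝ) := by
  refine ⟨measurable_card_sites_inter n, n, fun XY => ?_⟩
  dsimp only
  rw [abs_of_nonneg (Nat.cast_nonneg _)]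
  exact_mod_cast (Finset.card_le_card Finset.inter_subset_left).trans
    (Finset.card_image_le.trans (Finset.card_range n).le)

/-- Given `ω` the walks are independent, so the square is the probability that both visit `z`;
summing over `z` counts common sites. -/
lemma sum_sq_hitProb_le {ω : Env d} (hκ : ∀ x, κ (ω x) = (ω x).toMeasure) (n : ℕ)
    (t : Finset (Lattice d)) :
    ∑ z ∈ t, hitProb κ {z} n 0 ω ^ 2 ≤
      ∫ XY, ((sites XY.1 n ∩ sites XY.2 n).card : ℝ) ∂((quenched 0 ×ₖ quenched 0) ω) := by
  have hb : ∀ z : Lattice d, BddMeas fun XY : Path d × Path d =>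
      (if z ∈ sites XY.1 n then (1 : ℝ) else 0) * (if z ∈ sites XY.2 n then (1 : ℝ) else 0) :=
    fun z => ((bddMeas_sites n z).comp measurable_fst).mul
      ((bddMeas_sites n z).comp measurable_snd)
  have e : ∀ z : Lattice d, hitProb κ {z} n 0 ω ^ 2 =
      ∫ XY, (if z ∈ sites XY.1 n then (1 : ℝ) else 0) * (if z ∈ sites XY.2 n then (1 : ℝ) else 0)
        ∂((quenched 0 ×ₖ quenched 0) ω) := by
    intro z
    rw [Kernel.prod_apply, integral_prod_mul (fun X : Path d => if z ∈ sites X n then (1 : ℝ) else 0)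
      (fun X : Path d => if z ∈ sites X n then (1 : ℝ) else 0), sq,
      ← integral_sites_eq_hitProb hκ]
    rfl
  simp only [e]
  rw [← integral_finsetSum _ fun z _ => (hb z).integrable _]
  refine integral_mono (integrable_finsetSum _ fun z _ => (hb z).integrable _)
    ((bddMeas_card_sites_inter n).integrable _) fun XY => ?_
  have : ∀ z : Lattice d, (if z ∈ sites XY.1 n then (1 : ℝ) else 0) *
      (if z ∈ sites XY.2 n then (1 : ℝ) else 0) =
      if z ∈ sites XY.1 n ∩ sites XY.2 n then 1 else 0 := by
    intro z
    rw [ite_zero_mul_ite_zero, one_mul]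
    simp only [Finset.mem_inter]
  simp only [this]
  rw [Finset.sum_boole]
  exact_mod_cast Finset.card_le_card fun z hz => (Finset.mem_filter.1 hz).2

lemma integral_averagedPair (P : Measure (Env d)) [IsProbabilityMeasure P]
    {f : Path d × Path d → ℝ} (hf : BddMeas f) :
    ∫ XY, f XY ∂(averagedPair P 0 0) = ∫ ω, ∫ XY, f XY ∂((quenched 0 ×ₖ quenched 0) ω) ∂P := by
  rw [averagedPair, Measure.comp_eq_comp_const_apply, Kernel.integral_comp (hf.integrable _),
    Kernel.const_apply]

lemma integrable_averaged (P : Measure (Env d)) [IsProbabilityMeasure P] {D : ℝ≥0∞} (hD : D ≠ ∞)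
    (h : ∀ᵐ ω ∂P, ∀ x, ∫⁻ y, ‖toEuclid y‖ₑ ∂(ω x).toMeasure ≤ D) (n : ℕ) :
    Integrable (fun X : Path d => toEuclid (X n)) (averaged P 0) := by
  refine ⟨(measurable_toEuclid_coord n).aestronglyMeasurable, ?_⟩
  rw [HasFiniteIntegral, averaged, Measure.lintegral_bind (quenched 0).aemeasurable
    (measurable_toEuclid_coord n).enorm.aemeasurable]
  have : ∫⁻ ω, ∫⁻ X, ‖toEuclid (X n)‖ₑ ∂(quenched 0 ω) ∂P ≤ ∫⁻ _ω, n * D ∂P := by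
    refine lintegral_mono_ae ?_
    filter_upwards [h] with ω hω
    exact lintegral_enorm_quenchedLaw_le hω n
  refine this.trans_lt ?_
  simpa using ENNReal.mul_lt_top (ENNReal.natCast_lt_top n) hD.lt_top

lemma averagedMean_eq (P : Measure (Env d)) [IsProbabilityMeasure P] {n : ℕ}
    (h : Integrable (fun X : Path d => toEuclid (X n)) (averaged P 0)) :
    averagedMean P n = ∫ ω, quenchedMean n ω ∂P := by
  rw [averaged, Measure.comp_eq_comp_const_apply] at h
  rw [averagedMean, averaged, Measure.comp_eq_comp_const_apply, Kernel.integral_comp h,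
    Kernel.const_apply]
  rfl

lemma stronglyMeasurable_quenchedMean (n : ℕ) :
    StronglyMeasurable (quenchedMean (d := d) n) :=
  StronglyMeasurable.integral_kernel (κ := quenched (d := d) 0)
    (measurable_toEuclid_coord n).stronglyMeasurable

end Intersections

/-! ### Choice of the slab thickness. -/

section Rates

/-- With slabs of logarithmic thickness the oscillation grows like an arbitrarily small power. -/
lemma exists_oscBound_le {s s' ρ C : ℝ} (hs : 0 < s) (hs' : 0 ≤ s') (hρ : ρ < 1) (hC : 0 ≤ C) :
    ∃ K : ℝ, 0 ≤ K ∧ ∀ n : ℕ, 1 ≤ n → ∃ L : ℕ, 1 ≤ L ∧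
      Real.exp (-s * L) ≤ (n : ℝ) ^ (-3 : ℝ) ∧
      0 ≤ oscBound s s' ρ C n L + slabCost s' ρ C L ∧
      oscBound s s' ρ C n L + slabCost s' ρ C L ≤ K * (n : ℝ) ^ (3 * s' / s) := by
  have hρ' : 0 < 1 - ρ := by linarith
  have he : 0 < 1 - Real.exp (-s) := by
    have : Real.exp (-s) < 1 := Real.exp_lt_one_iff.2 (by linarith)
    linarith
  -- The exponent `3 * s'` appears because `L + 1` exceeds `3 * log n / s` by at most 3: one for the
  -- ceiling and two for the added units.
  set K₁ := 4 * C / (1 - ρ) * Real.exp (3 * s') with hK₁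
  have hK₁0 : 0 ≤ K₁ := by positivity
  refine ⟨(2 * C + K₁) / (1 - Real.exp (-s)) + K₁, by positivity, fun n hn => ?_⟩
  have hn' : (1 : ℝ) ≤ n := by exact_mod_cast hn
  have hn0 : (0 : ℝ) < n := by linarith
  have hlog : 0 ≤ Real.log n := Real.log_nonneg hn'
  -- The factor 3 gives `exp (-s * L) ≤ n ^ (-3)`, enough against the factor `n ^ 3` in the variance
  -- bound.
  refine ⟨⌈3 * Real.log n / s⌉₊ + 1, by omega, ?_, ?_⟩
  · rw [Real.rpow_def_of_pos hn0]
    refine Real.exp_le_exp.2 ?_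
    have h := Nat.le_ceil (3 * Real.log n / s)
    rw [div_le_iff₀ hs] at h
    push_cast
    nlinarith
  · set L := ⌈3 * Real.log n / s⌉₊ + 1 with hL
    have hpow : (1 : ℝ) ≤ (n : ℝ) ^ (3 * s' / s) := Real.one_le_rpow hn' (by positivity)
    have h1 : 2 * C * n * Real.exp (-s * L) ≤ 2 * C := by
      have : Real.exp (-s * L) ≤ (n : ℝ)⁻¹ := by
        rw [← Real.exp_log hn0, ← Real.exp_neg]
        refine Real.exp_le_exp.2 ?_
        have h := Nat.le_ceil (3 * Real.log n / s)
        rw [div_le_iff₀ hs] at h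
        rw [hL]
        push_cast
        nlinarith
      calc 2 * C * n * Real.exp (-s * L) ≤ 2 * C * n * (n : ℝ)⁻¹ := by gcongr
        _ = 2 * C := by field_simp
    have h2 : slabCost s' ρ C L ≤ K₁ * (n : ℝ) ^ (3 * s' / s) := by
      rw [slabCost, hK₁, mul_assoc]
      refine mul_le_mul_of_nonneg_left ?_ (by positivity)
      rw [Real.rpow_def_of_pos hn0, ← Real.exp_add]
      refine Real.exp_le_exp.2 ?_
      have h := (Nat.ceil_lt_add_one (by positivity : 0 ≤ 3 * Real.log n / s)).le
      have e : Real.log n * (3 * s' / s) = s' * (3 * Real.log n / s) := by ring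
      rw [e, hL]
      push_cast
      nlinarith
    have h3 : 0 ≤ slabCost s' ρ C L := by rw [slabCost]; positivity
    have h4 : oscBound s s' ρ C n L ≤
        (2 * C + K₁) / (1 - Real.exp (-s)) * (n : ℝ) ^ (3 * s' / s) := by
      rw [oscBound, div_mul_eq_mul_div]
      refine div_le_div_of_nonneg_right ?_ he.le
      nlinarith
    have h5 : 0 ≤ oscBound s s' ρ C n L := by
      rw [oscBound]; positivity
    exact ⟨add_nonneg h5 h3, by linarith⟩

end Rates

/-! ### From coordinates of the additive functional to the variance of the quenched mean. -/

section Assembly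

variable {d : ℕ} (μ : Measure (Simplex d)) [IsProbabilityMeasure μ]

instance : IsProbabilityMeasure (iidEnv μ) := by unfold iidEnv; infer_instance

lemma norm_quenchedMean_le {ω : Env d} {C : ℝ} (hC : 0 ≤ C)
    (hω : ∀ x, ∫⁻ y, ‖toEuclid y‖ₑ ∂(ω x).toMeasure ≤ ENNReal.ofReal C) (n : ℕ) :
    ‖quenchedMean n ω‖ ≤ n * C := by
  have h : ‖quenchedMean n ω‖ₑ ≤ n * ENNReal.ofReal C :=
    (enorm_integral_le_lintegral_enorm _).trans (lintegral_enorm_quenchedLaw_le hω n)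
  rw [← ofReal_norm, ← ENNReal.ofReal_natCast, ← ENNReal.ofReal_mul (Nat.cast_nonneg n)] at h
  exact (ENNReal.ofReal_le_ofReal_iff (by positivity)).1 h

lemma memLp_quenchedMean {C : ℝ} (hC : 0 ≤ C)
    (h : ∀ᵐ ω ∂(iidEnv μ), ∀ x, ∫⁻ y, ‖toEuclid y‖ₑ ∂(ω x).toMeasure ≤ ENNReal.ofReal C) (n : ℕ) :
    MemLp (quenchedMean (d := d) n) 2 (iidEnv μ) :=
  MemLp.of_bound (stronglyMeasurable_quenchedMean n).aestronglyMeasurable (n * C)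
    (h.mono fun _ hω => norm_quenchedMean_le hC hω n)

variable {κ : Kernel (Simplex d) (Lattice d)} [IsMarkovKernel κ]

lemma sum_integral_hitProb_le (hκ : ∀ᵐ ω ∂(iidEnv μ), ∀ x, κ (ω x) = (ω x).toMeasure) (n : ℕ)
    (t : Finset (Lattice d)) : ∑ z ∈ t, ∫ ω, hitProb κ {z} n 0 ω ∂(iidEnv μ) ≤ n := by
  have hi : ∀ z : Lattice d, Integrable (hitProb (S := Simplex d) κ {z} n 0) (iidEnv μ) :=
    fun z => ((unifBdd_hitProb _ n).bddMeas 0).integrable _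
  rw [← integral_finsetSum _ fun z _ => hi z]
  refine (integral_mono_ae (integrable_finsetSum _ fun z _ => hi z) (integrable_const (n : ℝ))
    (hκ.mono fun ω hω => sum_hitProb_le hω n t)).trans ?_
  simp

lemma sum_integral_sq_hitProb_le (hκ : ∀ᵐ ω ∂(iidEnv μ), ∀ x, κ (ω x) = (ω x).toMeasure) (n : ℕ)
    (t : Finset (Lattice d)) : ∑ z ∈ t, ∫ ω, hitProb κ {z} n 0 ω ^ 2 ∂(iidEnv μ) ≤
      ∫ XY, ((sites XY.1 n ∩ sites XY.2 n).card : ℝ) ∂(averagedPair (iidEnv μ) 0 0) := by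
  have hi : ∀ z : Lattice d, Integrable (fun ω : Env d => hitProb κ {z} n 0 ω ^ 2) (iidEnv μ) :=
    fun z => ((unifBdd_hitProb _ n).bddMeas 0).pow.integrable _
  rw [← integral_finsetSum _ fun z _ => hi z, integral_averagedPair _ (bddMeas_card_sites_inter n)]
  refine integral_mono_ae (integrable_finsetSum _ fun z _ => hi z)
    (BddMeas.integrable (BddMeas.integral_kernel (κ := quenched (d := d) 0 ×ₖ quenched 0)
      ((bddMeas_card_sites_inter n).comp measurable_snd)) _)
    (hκ.mono fun ω hω => sum_sq_hitProb_le hω n t)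

/-- The variance of the quenched mean, from the variances of its coordinates. -/
lemma integral_norm_sq_quenchedMean_sub_le {C : ℝ}
    (h : ∀ᵐ ω ∂(iidEnv μ), ∀ x, ∫⁻ y, ‖toEuclid y‖ₑ ∂(ω x).toMeasure ≤ ENNReal.ofReal C)
    (hC : 0 ≤ C) {n : ℕ} {f : Fin d → Env d → ℝ} (hf : ∀ i, BddMeas (f i))
    (hq : ∀ᵐ ω ∂(iidEnv μ), ∀ i, quenchedMean n ω i = f i ω) {B : ℝ}
    (hB : ∀ i, ∫ ω, (f i ω - ∫ ω, f i ω ∂(iidEnv μ)) ^ 2 ∂(iidEnv μ) ≤ B) :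
    ∫ ω, ‖quenchedMean n ω - averagedMean (iidEnv μ) n‖ ^ 2 ∂(iidEnv μ) ≤ d * B := by
  have hint : Integrable (quenchedMean (d := d) n) (iidEnv μ) :=
    (memLp_quenchedMean μ hC h n).integrable (by norm_num)
  have hmean : ∀ i, averagedMean (iidEnv μ) n i = ∫ ω, f i ω ∂(iidEnv μ) := by
    intro i
    rw [averagedMean_eq _ (integrable_averaged _ ENNReal.ofReal_ne_top h n)]
    have e := (EuclideanSpace.proj i : EuclideanSpace ℝ (Fin d) →L[ℝ] ℝ).integral_comp_comm hint
    refine e.symm.trans (integral_congr_ae ?_)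
    filter_upwards [hq] with ω hω using hω i
  have hsum : ∀ᵐ ω ∂(iidEnv μ), ‖quenchedMean n ω - averagedMean (iidEnv μ) n‖ ^ 2 =
      ∑ i, (f i ω - ∫ ω, f i ω ∂(iidEnv μ)) ^ 2 := by
    filter_upwards [hq] with ω hω
    rw [EuclideanSpace.norm_sq_eq]
    refine Finset.sum_congr rfl fun i _ => ?_
    rw [PiLp.sub_apply, hω i, hmean i, Real.norm_eq_abs, sq_abs]
  rw [integral_congr_ae hsum, integral_finsetSum _ fun i _ =>
    ((hf i).sub (BddMeas.const _)).pow.integrable _]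
  refine (Finset.sum_le_sum fun i _ => hB i).trans ?_
  simp

/-- The second term has order `n ^ 2 * n ^ (-3) * n = 1`, absorbed by the power because its exponent
is nonnegative. -/
lemma variance_bound_le_rpow {n a b B K I c e C : ℝ} (hn : 1 ≤ n) (ha : 0 ≤ a) (hb : 0 ≤ b)
    (hB0 : 0 ≤ B) (hB : B ≤ K * n ^ b) (hI0 : 0 ≤ I) (hI : I ≤ c * n ^ (2 * a))
    (he : e ≤ n ^ (-3 : ℝ)) :
    2 * B ^ 2 * I + 2 * (2 * C * n) ^ 2 * e * n ≤
      (2 * K ^ 2 * c + 8 * C ^ 2) * n ^ (2 * (a + b)) := by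
  have hn0 : 0 < n := by linarith
  have hpow : 1 ≤ n ^ (2 * (a + b)) := Real.one_le_rpow hn (by positivity)
  have h1 : 2 * B ^ 2 * I ≤ 2 * K ^ 2 * c * n ^ (2 * (a + b)) := by
    calc 2 * B ^ 2 * I ≤ 2 * (K * n ^ b) ^ 2 * (c * n ^ (2 * a)) := by gcongr
      _ = 2 * K ^ 2 * c * (n ^ b * n ^ b * n ^ (2 * a)) := by ring
      _ = _ := by
        rw [← Real.rpow_add hn0, ← Real.rpow_add hn0]
        congr 2
        ring
  have h2 : 2 * (2 * C * n) ^ 2 * e * n ≤ 8 * C ^ 2 * n ^ (2 * (a + b)) := by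
    calc 2 * (2 * C * n) ^ 2 * e * n ≤ 2 * (2 * C * n) ^ 2 * n ^ (-3 : ℝ) * n := by gcongr
      _ = 8 * C ^ 2 * (n ^ (3 : ℕ) * n ^ (-3 : ℝ)) := by ring
      _ = 8 * C ^ 2 * 1 := by
        rw [← Real.rpow_natCast n 3, ← Real.rpow_add hn0]
        norm_num
      _ ≤ _ := by gcongr
  rw [add_mul]
  exact add_le_add h1 h2

end Assembly

/-- The variance of the quenched mean is at most `n^{2α}` with `α < 1/2`. -/
lemma variance_quenchedMean_isBigO {d : ℕ} {μ : Measure (Simplex d)} [IsProbabilityMeasure μ]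
    {u : Lattice d} {s s' ρ C : ℝ} (hs' : 0 < s') (hss : s' ≤ s) (hρ0 : 0 ≤ ρ) (hρ : ρ < 1)
    (hC : 0 ≤ C) (hgood : ∀ᵐ ω ∂(iidEnv μ), GoodSite u s s' ρ C (ω 0)) {a : ℝ} (ha0 : 0 ≤ a)
    (hInt : (fun n : ℕ => ∫ XY, ((sites XY.1 n ∩ sites XY.2 n).card : ℝ)
      ∂(averagedPair (iidEnv μ) 0 0)) =O[atTop] (fun n : ℕ => (n : ℝ) ^ (2 * a))) :
    (fun n : ℕ => ∫ ω, ‖quenchedMean n ω - averagedMean (iidEnv μ) n‖ ^ 2 ∂(iidEnv μ))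
      =O[atTop] (fun n : ℕ => (n : ℝ) ^ (2 * (a + 3 * s' / s))) := by
  have hs : 0 < s := hs'.trans_le hss
  obtain ⟨⟨p₀, hp₀⟩, hae⟩ := ae_goodSite μ hgood
  have hD := upwardDrift_goodKernel hp₀ hs' hss hρ0 hρ
  set κ := goodKernel u s s' ρ C p₀ with hκ
  have hκae : ∀ᵐ ω ∂(iidEnv μ), ∀ x, κ (ω x) = (ω x).toMeasure :=
    hae.mono fun ω hω x => goodKernel_of_good p₀ (hω x)
  have hmom : ∀ᵐ ω ∂(iidEnv μ), ∀ x,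
      ∫⁻ y, ‖toEuclid y‖ₑ ∂(ω x).toMeasure ≤ ENNReal.ofReal C :=
    hae.mono fun ω hω x => (hω x).2.2
  have hβ := fun i => measurable_localDrift u s s' ρ C i
  have hβC := fun i => abs_localDrift_le u s s' ρ hC i
  have hq : ∀ n, ∀ᵐ ω ∂(iidEnv μ), ∀ i,
      quenchedMean n ω i = expSum κ (localDrift u s s' ρ C i) n 0 ω := by
    intro n
    filter_upwards [hae, hκae] with ω hω hκω i
    exact quenchedMean_apply hκω ENNReal.ofReal_ne_top (fun x => (hω x).2.2)
      (fun x => if_pos (hω x)) (hβ i) (hβC i) n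
  obtain ⟨K, hK0, hK⟩ := exists_oscBound_le hs hs'.le hρ hC
  obtain ⟨c, hc0, hc⟩ := hInt.exists_pos
  refine IsBigO.of_bound (d * (2 * K ^ 2 * c + 8 * C ^ 2)) ?_
  filter_upwards [hc.bound, eventually_ge_atTop 1] with n hn hn1
  have hn1' : (1 : ℝ) ≤ n := by exact_mod_cast hn1
  have hn0 : (0 : ℝ) < n := by linarith
  have hb0 : 0 ≤ 3 * s' / s := by positivity
  obtain ⟨L, hL, hLn, hB0, hB⟩ := hK n hn1
  set I := ∫ XY, ((sites XY.1 n ∩ sites XY.2 n).card : ℝ) ∂(averagedPair (iidEnv μ) 0 0) with hI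
  have hI0 : 0 ≤ I := integral_nonneg fun _ => Nat.cast_nonneg _
  rw [Real.norm_eq_abs, abs_of_nonneg hI0, Real.norm_eq_abs,
    abs_of_nonneg (Real.rpow_nonneg hn0.le _)] at hn
  have hvar : ∀ i, ∫ ω, (expSum κ (localDrift u s s' ρ C i) n 0 ω -
      ∫ ω, expSum κ (localDrift u s s' ρ C i) n 0 ω ∂(iidEnv μ)) ^ 2 ∂(iidEnv μ) ≤
      2 * (oscBound s s' ρ C n L + slabCost s' ρ C L) ^ 2 * I +
        2 * (2 * C * n) ^ 2 * Real.exp (-s * L) * n := fun i =>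
    variance_expSum_le μ hD (hβ i) (hβC i) hL (sum_integral_hitProb_le μ hκae n)
      (sum_integral_sq_hitProb_le μ hκae n)
  rw [Real.norm_eq_abs, abs_of_nonneg (integral_nonneg fun _ => by positivity), Real.norm_eq_abs,
    abs_of_nonneg (Real.rpow_nonneg hn0.le _)]
  refine (integral_norm_sq_quenchedMean_sub_le μ hmom hC
    (fun i => (unifBdd_expSum (hβ i) (hβC i) n).bddMeas 0) (hq n)
    (fun i => (hvar i).trans (variance_bound_le_rpow hn1' ha0 hb0 hB0 hB hI0 hn hLn))).trans
      (le_of_eq ?_)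
  ring

end RWRE

theorem proposition6p1 {d : ℕ} (μ : Measure (RWRE.Simplex d)) [IsProbabilityMeasure μ]
    (hN : RWRE.NonNestling (RWRE.iidEnv μ))
    (hM : RWRE.ExpMoment (RWRE.iidEnv μ))
    (hInt : ∃ αbar : ℝ, αbar < 1 / 2 ∧
      (fun n : ℕ => ∫ XY, ((RWRE.sites XY.1 n ∩ RWRE.sites XY.2 n).card : ℝ)
          ∂(RWRE.averagedPair (RWRE.iidEnv μ) 0 0))
        =O[atTop] (fun n : ℕ => (n : ℝ) ^ (2 * αbar))) :
    (∀ n : ℕ,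
      Integrable (fun X : RWRE.Path d => RWRE.toEuclid (X n)) (RWRE.averaged (RWRE.iidEnv μ) 0) ∧
      MemLp (RWRE.quenchedMean (d := d) n) 2 (RWRE.iidEnv μ)) ∧
    ∃ α : ℝ, α < 1 / 2 ∧
      (fun n : ℕ => ∫ ω, ‖RWRE.quenchedMean n ω - RWRE.averagedMean (RWRE.iidEnv μ) n‖ ^ 2
          ∂(RWRE.iidEnv μ))
        =O[atTop] (fun n : ℕ => (n : ℝ) ^ (2 * α)) := by
  obtain ⟨u, s, δ, C, hs, hδ, hC, hsδ, hgood⟩ := RWRE.exists_goodSite hN hM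
  obtain ⟨αbar, hα, hInt⟩ := hInt
  -- A negative `αbar` is replaced by 0, since the bounded error terms need a nonnegative exponent.
  set a := max αbar 0 with ha
  have ha0 : 0 ≤ a := le_max_right _ _
  have ha2 : a < 1 / 2 := max_lt hα (by norm_num)
  have hInt' := hInt.trans (show (fun n : ℕ => (n : ℝ) ^ (2 * αbar)) =O[atTop]
      (fun n : ℕ => (n : ℝ) ^ (2 * a)) by
    refine IsBigO.of_bound 1 ?_
    filter_upwards [eventually_ge_atTop 1] with n hn
    have hn1 : (1 : ℝ) ≤ n := by exact_mod_cast hn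
    rw [Real.norm_eq_abs, abs_of_nonneg (by positivity), Real.norm_eq_abs,
      abs_of_nonneg (by positivity), one_mul]
    exact Real.rpow_le_rpow_of_exponent_le hn1 (by linarith [le_max_left αbar 0]))
  -- With `s' = s * ε` the loss `3 * s' / s = 3 * ε` is half the gap between `a` and `1 / 2`.
  set ε := (1 / 2 - a) / 6 with hε
  have hε0 : 0 < ε := by rw [hε]; linarith
  have hε1 : ε ≤ 1 := by rw [hε]; linarith
  have hs' : 0 < s * ε := mul_pos hs hε0
  have hss : s * ε ≤ s := mul_le_of_le_one_right hs.le hε1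
  have hg := hgood (s * ε) hs'.le hss
  have hmom : ∀ᵐ ω ∂(RWRE.iidEnv μ), ∀ x,
      ∫⁻ y, ‖RWRE.toEuclid y‖ₑ ∂(ω x).toMeasure ≤ ENNReal.ofReal C :=
    (RWRE.ae_goodSite μ hg).2.mono fun ω hω x => (hω x).2.2
  refine ⟨fun n => ⟨RWRE.integrable_averaged _ ENNReal.ofReal_ne_top hmom n,
    RWRE.memLp_quenchedMean μ hC hmom n⟩, a + 3 * (s * ε) / s, ?_, ?_⟩
  · have : 3 * (s * ε) / s = 3 * ε := by field_simp
    rw [this, hε]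
    linarith
  · refine RWRE.variance_quenchedMean_isBigO hs' hss ?_ ?_ hC hg ha0 hInt'
    · nlinarith [mul_le_mul_of_nonneg_right hss hδ.le]
    · nlinarith [mul_pos hs' hδ]
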